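/- Let $1<p,q<\infty$ with $\frac1p+\frac1q=1$ and let $\alpha>-1$. Let $\mathcal H=\{x+iy: y>0\}$, $dV_\alpha(x+iy)=y^\alpha\,dx\,dy$, $\|h\|_{p,\alpha}=\left(\int_{\mathcal H}|h|^p\,dV_\alpha\right)^{1/p}\in[0,\infty]$, and let $A^p_\alpha(\mathcal H)$ be the space of analytic $h$ on $\mathcal H$ with $\|h\|_{p,\alpha}<\infty$. Let $$K_w^\alpha(z)=K^\alpha(z,w)=\frac{2^\alpha(\alpha+1)}{\pi}\left(\frac{z-\overline w}{i}\right)^{-(2+\alpha)}$$ (principal branch) be the reproducing kernel of $A^2_\alpha(\mathcal H)$, let $k_w^\alpha=K_w^\alpha/\|K_w^\alpha\|_{2,\alpha}$, let $P_\alpha u(z)=\int_{\mathcal H}K^\alpha(z,\zeta)u(\zeta)\,dV_\alpha(\zeta)$, and $T_\varphi h=P_\alpha(\varphi h)$. For analytic $f,g$ on $\mathcal H$ we say that $T_fT_{\overline g}$ is bounded on $A^p_\alpha(\mathcal H)$ if, for every $h\in A^p_\alpha(\mathcal H)$, the integrals defining $T_{\overline g}h$ and $T_f(T_{\overline g}h)$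 converge absolutely at every point of $\mathcal H$, $T_fT_{\overline g}h\in A^p_\alpha(\mathcal H)$, and $\|T_fT_{\overline g}h\|_{p,\alpha}\le M\|h\|_{p,\alpha}$ with $M<\infty$ independent of $h$; the least such $M$ is the norm $\|T_fT_{\overline g}\|_{A^p_\alpha\to A^p_\alpha}$, which is $\infty$ if the product is not bounded. There is a constant $C$, depending only on $p$ and $\alpha$, such that the following holds. Let $f,g$ be analytic on $\mathcal H$, $f\not\equiv0$, and suppose that $$[f]_{p,\alpha}:=\sup_{w\in\mathcal H}\|fk_w^\alpha\|_{p,\alpha}\,\|f^{-1}k_w^\alpha\|_{q,\alpha}<\infty .$$ Then $T_fT_{\overline g}$ is bounded on $A^p_\alpha(\mathcal H)$ if and only if $$[f,g]_{p,\alpha}:=\sup_{w\in\mathcal H}\|fk_w^\alpha\|_{p,\alpha}\,\|gk_w^\alpha\|_{q,\alpha}<\infty .$$ Moreover, $$\|T_fT_{\overline g}\|_{A^p_\alpha\to A^p_\alpha}\le C\,[f,g]_{p,\alpha}\,[f]_{p,\alpha}^{\max\{p,q\}},\qquad [f,g]_{p,\alpha}\le C\,\|T_gT_{\overline f}\|_{A^q_\alpha\to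 A^q_\alpha}\,[f]_{p,\alpha}.$$ -/

import Mathlib

noncomputable section

namespace BergmanHalfPlane

open MeasureTheory
open scoped ENNReal NNReal ComplexConjugate

/-- The open upper half-plane as a subset of `ℂ`. Functions on it are represented by functions
`ℂ → ℂ`; nothing below depends on their values off this set. -/
def halfPlane : Set ℂ := {z : ℂ | 0 < z.im}

/-- The measure `dV_α (x + i y) = y ^ α dx dy` on the upper half-plane. -/
def V (α : ℝ) : Measure ℂ :=
  (volume.restrict halfPlane).withDensity fun z => ENNReal.ofReal (z.im ^ α)

/-- `‖h‖_{p,α} = (∫ |h| ^ p dV_α) ^ (1 / p)`, with value `∞` allowed. -/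
def wnorm (p α : ℝ) (h : ℂ → ℂ) : ℝ≥0∞ := eLpNorm h (ENNReal.ofReal p) (V α)

/-- Membership in the weighted Bergman space `A^p_α` of the upper half-plane. -/
def MemBergman (p α : ℝ) (h : ℂ → ℂ) : Prop :=
  DifferentiableOn ℂ h halfPlane ∧ wnorm p α h < ∞

/-- The reproducing kernel of `A^2_α`,
`K_α(z,w) = (2 ^ α (α + 1) / π) ((z - w̄) / i) ^ (-(2 + α))`.
For `z, w` in the half-plane, `(z - w̄) / i` has positive real part, so that the principal
branch of the power is holomorphic in `z`. -/
def kernel (α : ℝ) (z w : ℂ) : ℂ :=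
  ((2 ^ α * (α + 1) / Real.pi : ℝ) : ℂ) *
    ((z - conj w) / Complex.I) ^ (-(2 + α : ℝ) : ℂ)

/-- The normalized reproducing kernel `k_w = K_w / ‖K_w‖_{2,α}`. -/
def normKernel (α : ℝ) (w z : ℂ) : ℂ :=
  kernel α z w / ((wnorm 2 α fun ζ => kernel α ζ w).toReal : ℂ)

/-- `P_α u` is defined at every point of the half-plane by an absolutely convergent integral. -/
def ProjDefined (α : ℝ) (u : ℂ → ℂ) : Prop :=
  ∀ z ∈ halfPlane, Integrable (fun ζ => kernel α z ζ * u ζ) (V α)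

/-- The Bergman projection `P_α u (z) = ∫ K_α(z,ζ) u(ζ) dV_α(ζ)`. -/
def proj (α : ℝ) (u : ℂ → ℂ) (z : ℂ) : ℂ := ∫ ζ, kernel α z ζ * u ζ ∂(V α)

/-- The Toeplitz operator `T_φ h = P_α (φ h)`. -/
def toeplitz (α : ℝ) (φ h : ℂ → ℂ) : ℂ → ℂ := proj α fun z => φ z * h z

/-- `T_φ h` is defined. -/
def ToeplitzDefined (α : ℝ) (φ h : ℂ → ℂ) : Prop := ProjDefined α fun z => φ z * h z

/-- The Toeplitz product `T_f T_{ḡ} h`. -/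
def toeplitzProd (α : ℝ) (f g h : ℂ → ℂ) : ℂ → ℂ :=
  toeplitz α f (toeplitz α (fun z => conj (g z)) h)

/-- `T_f T_{ḡ}` is defined on all of `A^p_α`, maps it to itself, and has norm at most `M`. -/
def ProdBoundedBy (p α : ℝ) (f g : ℂ → ℂ) (M : ℝ≥0) : Prop :=
  ∀ h : ℂ → ℂ, MemBergman p α h →
    ToeplitzDefined α (fun z => conj (g z)) h ∧
    ToeplitzDefined α f (toeplitz α (fun z => conj (g z)) h) ∧
    MemBergman p α (toeplitzProd α f g h) ∧
    wnorm p α (toeplitzProd α f g h) ≤ M * wnorm p α h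

/-- `T_f T_{ḡ}` is a bounded operator on `A^p_α`. -/
def ProdBounded (p α : ℝ) (f g : ℂ → ℂ) : Prop := ∃ M : ℝ≥0, ProdBoundedBy p α f g M

/-- The operator norm of `T_f T_{ḡ}` on `A^p_α`; it is `∞` if the product is not bounded. -/
def prodNorm (p α : ℝ) (f g : ℂ → ℂ) : ℝ≥0∞ :=
  ⨅ (M : ℝ≥0) (_ : ProdBoundedBy p α f g M), (M : ℝ≥0∞)

/-- The Sarason quantity `[f,g]_{p,α} = sup_w ‖f k_w‖_{p,α} ‖g k_w‖_{q,α}`. -/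
def sarason (p q α : ℝ) (f g : ℂ → ℂ) : ℝ≥0∞ :=
  ⨆ w ∈ halfPlane,
    wnorm p α (fun z => f z * normKernel α w z) * wnorm q α (fun z => g z * normKernel α w z)

/-- The invariant quantity `[f]_{p,α} = sup_w ‖f k_w‖_{p,α} ‖f⁻¹ k_w‖_{q,α}`. -/
def invariantConst (p q α : ℝ) (f : ℂ → ℂ) : ℝ≥0∞ :=
  ⨆ w ∈ halfPlane,
    wnorm p α (fun z => f z * normKernel α w z) *
      wnorm q α (fun z => (f z)⁻¹ * normKernel α w z)

end BergmanHalfPlane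

end

noncomputable section

namespace BergmanHalfPlane

open MeasureTheory Set
open scoped ENNReal NNReal ComplexConjugate

/-! Under the hypothesis that `[f]` is finite, the Sarason condition is a quantitative form of
boundedness of the product `f g`. The reproducing formula for `f g K_w` at `w`, together with
Hölder's inequality, gives `|f(w) g(w)| ≤ ‖f k_w‖_p ‖g k_w‖_q`, so `|f g| ≤ [f,g]` on the
half-plane. Conversely, `|f g| ≤ B` means `|g| ≤ B |f|⁻¹` almost everywhere, whence `[f,g] ≤ B [f]`.

Necessity: kernel functions are eigenvectors of co-analytic Toeplitz operators, so `T_f T_ḡ K_w` is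
the conjugate of `g(w)` times `f K_w`. Testing the product on `K_w` and using `|f(w)| ≤ ‖f k_w‖_p
‖k_w‖_q` gives `|f(w) g(w)| ≤ M ‖k_w‖_p ‖k_w‖_q`, where the last product is bounded in `w`. The
conclusion is symmetric in `f` and `g`, so a bound for `T_g T_f̄` on `A^q` serves equally well
(`enorm_mul_le_of_prodBoundedBy`, `sarason_le_of_enorm_mul_le`).

Sufficiency: the outer projection reproduces, so `T_f T_ḡ h = f P(ḡ h)`. This is dominated by `|f|
P⁺(|g h|)`, where `P⁺` has kernel `|K|`. Since `|f g h| ≤ [f,g] |h|`, it is enough that `P⁺` be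
bounded on `L^p(|f|^p)` with norm at most a multiple of `[f]^max(p,q)`
(`exists_lintegral_kernel_rpow_le`). On a Carleson box `Q` a suitable `|k_w|²` is at least a
constant over `V(Q)`, so `[f]` controls the Békollé–Bonami constant of `|f|^p`. Two adjacent dyadic
grids dominate the form of `P⁺` by two sparse forms (`lintegral_kernel_form_le`): the upper halves
of the boxes are disjoint and carry a fixed fraction of the mass. The sharp power comes from
`sparse_form_le`, which combines a numerical inequality for the masses with a Carleson embedding
whose constant does not depend on the measure.

The reproducing formula itself (`integral_kernel_mul`) is the mean value property on circles,
transported from the disc by a Cayley map. -/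

/-- Absorption: a finite quantity bounded by a multiple of its own `1 / q`-th power. -/
theorem le_rpow_of_le_mul_rpow {p q : ℝ} (hpq : p.HolderConjugate q) {x B : ℝ≥0∞} (hx : x ≠ ∞)
    (h : x ≤ B * x ^ (1 / q)) : x ≤ B ^ p := by
  rcases eq_or_ne x 0 with rfl | h0
  · simp
  have hxq0 : x ^ (1 / q) ≠ 0 := by simp [ENNReal.rpow_eq_zero_iff, h0, hx]
  have hxqt : x ^ (1 / q) ≠ ∞ := ENNReal.rpow_ne_top_of_nonneg hpq.symm.one_div_nonneg hx
  have h1 : x ^ (1 / p) ≤ B := by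
    rw [← ENNReal.mul_le_mul_iff_left hxq0 hxqt, ← ENNReal.rpow_add _ _ h0 hx]
    have : 1 / p + 1 / q = 1 := by simpa using hpq.inv_add_inv_eq_one
    rw [this, ENNReal.rpow_one]
    exact h
  calc x = (x ^ (1 / p)) ^ p := by
        rw [← ENNReal.rpow_mul, one_div_mul_cancel hpq.ne_zero, ENNReal.rpow_one]
    _ ≤ B ^ p := ENNReal.rpow_le_rpow h1 hpq.nonneg

/-! ### Sparse forms and weighted inequalities over nested families, in an abstract measure space.
-/

section Dyadic

variable {X ι : Type*} [MeasurableSpace X]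

/-- Two sets of a family are nested or disjoint. -/
def NestedFamily (Q : ι → Set X) : Prop :=
  ∀ i j, Q i ⊆ Q j ∨ Q j ⊆ Q i ∨ Disjoint (Q i) (Q j)

/-- An inequality between measures passes from the sets of a nested family to their finite unions. -/
theorem measure_biUnion_le_of_nested {Q : ι → Set X} (hn : NestedFamily Q)
    (hQ : ∀ i, MeasurableSet (Q i)) (S : Finset ι) (μ ν : Measure X)
    (h : ∀ i ∈ S, μ (Q i) ≤ ν (Q i)) : μ (⋃ i ∈ S, Q i) ≤ ν (⋃ i ∈ S, Q i) := by
  classical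
  -- The maximal members have the same union and are pairwise disjoint by nesting. They are
  -- collected as sets, not as indices, so that a set listed under several indices counts once.
  set 𝒬 : Finset (Set X) := (S.image Q).filter fun A => Maximal (· ∈ S.image Q) A with h𝒬
  have hU : (⋃ i ∈ S, Q i) = ⋃ A ∈ 𝒬, id A := by
    apply Subset.antisymm
    · refine iUnion₂_subset fun i hi => ?_
      obtain ⟨A, hA, hmax⟩ := (S.image Q).exists_le_maximal (Finset.mem_image_of_mem Q hi)
      exact fun x hx => mem_iUnion₂.2 ⟨A, Finset.mem_filter.2 ⟨hmax.prop, hmax⟩, hA hx⟩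
    · refine iUnion₂_subset fun A hA => ?_
      obtain ⟨i, hi, rfl⟩ := Finset.mem_image.1 (Finset.mem_filter.1 hA).1
      exact fun x hx => mem_iUnion₂.2 ⟨i, hi, hx⟩
  have hd : (𝒬 : Set (Set X)).PairwiseDisjoint id := by
    intro A hA B hB hAB
    have hA' := (Finset.mem_filter.1 (Finset.mem_coe.1 hA))
    have hB' := (Finset.mem_filter.1 (Finset.mem_coe.1 hB))
    obtain ⟨i, hi, rfl⟩ := Finset.mem_image.1 hA'.1
    obtain ⟨j, hj, rfl⟩ := Finset.mem_image.1 hB'.1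
    rcases hn i j with h1 | h1 | h1
    · exact absurd (subset_antisymm h1 (hA'.2.2 hB'.1 h1)) hAB
    · exact absurd (subset_antisymm (hB'.2.2 hA'.1 h1) h1) hAB
    · exact h1
  have hm : ∀ A ∈ 𝒬, MeasurableSet A ∧ μ A ≤ ν A := by
    intro A hA
    obtain ⟨i, hi, rfl⟩ := Finset.mem_image.1 (Finset.mem_filter.1 hA).1
    exact ⟨hQ i, h i hi⟩
  rw [hU, measure_biUnion_finset hd fun A hA => (hm A hA).1,
    measure_biUnion_finset hd fun A hA => (hm A hA).1]
  exact Finset.sum_le_sum fun A hA => (hm A hA).2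

/-- The `L^p` bound that follows from the weak-type estimate of Doob. -/
theorem lintegral_rpow_le_of_weakType {p q : ℝ} (hpq : p.HolderConjugate q) (σ : Measure X)
    {M : X → ℝ} (hM : Measurable M) (hM0 : 0 ≤ M) {φ : X → ℝ≥0∞} (hφ : Measurable φ)
    (hfin : ∫⁻ x, ENNReal.ofReal (M x ^ p) ∂σ ≠ ∞)
    (h : ∀ t : ℝ, 0 < t → ENNReal.ofReal t * σ {x | t < M x} ≤ ∫⁻ x in {x | t < M x}, φ x ∂σ) :
    ∫⁻ x, ENNReal.ofReal (M x ^ p) ∂σ ≤ ENNReal.ofReal q ^ p * ∫⁻ x, φ x ^ p ∂σ := by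
  have hp := hpq.lt
  have hset : ∀ t : ℝ, MeasurableSet {x | t < M x} := fun t => measurableSet_lt measurable_const hM
  -- Layer-cake formulas on both sides, for `σ` with exponent `p` and for `φ σ` with exponent `p -
  -- 1`; the factor is `p / (p - 1) = q`. After Hölder, `(p - 1) q = p` makes the left side reappear
  -- to the power `1 / q`, and it is absorbed.
  have key : ∫⁻ x, ENNReal.ofReal (M x ^ p) ∂σ
      ≤ ENNReal.ofReal q * ∫⁻ x, φ x * ENNReal.ofReal (M x ^ (p - 1)) ∂σ := by
    have h2 := lintegral_rpow_eq_lintegral_meas_lt_mul (σ.withDensity φ)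
      (Filter.Eventually.of_forall hM0) hM.aemeasurable (sub_pos.2 hp)
    rw [lintegral_withDensity_eq_lintegral_mul _ hφ (by fun_prop)] at h2
    simp only [Pi.mul_apply] at h2
    rw [h2, lintegral_rpow_eq_lintegral_meas_lt_mul σ
      (Filter.Eventually.of_forall hM0) hM.aemeasurable hpq.pos, ← mul_assoc,
      ← ENNReal.ofReal_mul hpq.symm.nonneg]
    have : q * (p - 1) = p := by
      have := hpq.mul_eq_add
      linarith
    rw [this]
    refine mul_le_mul' le_rfl ?_
    refine setLIntegral_mono' (measurableSet_Ioi (a := (0 : ℝ))) fun t ht => ?_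
    have ht : 0 < t := ht
    have e : t ^ (p - 1) = t * t ^ (p - 1 - 1) := by
      rw [← Real.rpow_one_add' ht.le (by linarith)]
      congr 1; ring
    rw [e, ENNReal.ofReal_mul ht.le, ← mul_assoc, mul_comm (σ _), withDensity_apply _ (hset t)]
    gcongr
    exact h t ht
  have hol := ENNReal.lintegral_mul_le_Lp_mul_Lq σ hpq hφ.aemeasurable
    (g := fun x => ENNReal.ofReal (M x ^ (p - 1))) (by fun_prop)
  simp only [Pi.mul_apply] at hol
  have e : ∀ x, ENNReal.ofReal (M x ^ (p - 1)) ^ q = ENNReal.ofReal (M x ^ p) := by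
    intro x
    rw [ENNReal.ofReal_rpow_of_nonneg (Real.rpow_nonneg (hM0 x) _) hpq.symm.nonneg,
      ← Real.rpow_mul (hM0 x)]
    congr 2
    have := hpq.mul_eq_add
    linarith
  simp only [e] at hol
  have h3 := le_rpow_of_le_mul_rpow hpq hfin (B := ENNReal.ofReal q * (∫⁻ x, φ x ^ p ∂σ) ^ (1 / p))
    (by rw [mul_assoc]; exact key.trans (by gcongr))
  rwa [ENNReal.mul_rpow_of_nonneg _ _ hpq.nonneg, ← ENNReal.rpow_mul,
    one_div_mul_cancel hpq.ne_zero, ENNReal.rpow_one] at h3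

/-- Carleson embedding for averages over a nested family, with a constant that does not depend on
the measure. -/
theorem sum_average_rpow_mul_measure_le {p q : ℝ} (hpq : p.HolderConjugate q) (σ : Measure X)
    {Q T : ι → Set X} (hn : NestedFamily Q) (hQ : ∀ i, MeasurableSet (Q i))
    (hT : ∀ i, MeasurableSet (T i)) (hTQ : ∀ i, T i ⊆ Q i)
    (hTd : Pairwise fun i j => Disjoint (T i) (T j)) (hσ : ∀ i, σ (Q i) ≠ ∞)
    {φ : X → ℝ≥0∞} (hφ : Measurable φ) (S : Finset ι) :
    ∑ i ∈ S, ((∫⁻ x in Q i, φ x ∂σ) / σ (Q i)) ^ p * σ (T i)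
      ≤ ENNReal.ofReal q ^ p * ∫⁻ x, φ x ^ p ∂σ := by
  classical
  rcases eq_or_ne (∫⁻ x, φ x ^ p ∂σ) ∞ with htop | hfin
  · rw [htop, ENNReal.mul_top]
    · exact le_top
    · simp [ENNReal.rpow_eq_zero_iff, hpq.symm.pos]
  have hint : ∀ i, ∫⁻ x in Q i, φ x ∂σ ≠ ∞ := by
    intro i
    have := ENNReal.lintegral_mul_le_Lp_mul_Lq (σ.restrict (Q i)) hpq hφ.aemeasurable
      (g := fun _ => 1) (by fun_prop)
    simp only [Pi.mul_apply, mul_one, ENNReal.one_rpow, lintegral_const, Measure.restrict_apply,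
      MeasurableSet.univ, univ_inter, one_mul] at this
    refine ne_top_of_le_ne_top (ENNReal.mul_ne_top ?_ ?_) this
    · refine ENNReal.rpow_ne_top_of_nonneg hpq.one_div_nonneg ?_
      exact ne_top_of_le_ne_top hfin (setLIntegral_le_lintegral _ _)
    · exact ENNReal.rpow_ne_top_of_nonneg hpq.symm.one_div_nonneg (hσ i)
  set a : ι → ℝ≥0∞ := fun i => (∫⁻ x in Q i, φ x ∂σ) / σ (Q i) with ha
  have hatop : ∀ i, a i ≠ ∞ := by
    intro i
    rcases eq_or_ne (σ (Q i)) 0 with h0 | h0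
    · have : ∫⁻ x in Q i, φ x ∂σ = 0 := setLIntegral_measure_zero _ _ h0
      simp [ha, this]
    · exact ENNReal.div_ne_top (hint i) h0
  -- The maximal function of the averages over the finite subfamily; it dominates the average `a i`
  -- on `T i`.
  set N : X → ℝ≥0∞ := fun x => S.sup fun i => (Q i).indicator (fun _ => a i) x with hN
  have hNm : Measurable N := by
    simp only [hN, Finset.sup_eq_iSup]
    exact Measurable.biSup _ S.countable_toSet fun i _ => measurable_const.indicator (hQ i)
  have hNle : ∀ x, N x ≤ ∑ i ∈ S, (Q i).indicator (fun _ => a i) x := fun x =>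
    Finset.sup_le fun i hi =>
      Finset.single_le_sum (f := fun i => (Q i).indicator (fun _ => a i) x)
        (fun _ _ => zero_le) hi
  have hNtop : ∀ x, N x ≠ ∞ := fun x => by
    refine ne_top_of_le_ne_top (ENNReal.sum_ne_top.2 fun i _ => ?_) (hNle x)
    by_cases hx : x ∈ Q i <;> simp [hx, hatop]
  have hNp : ∀ x, ENNReal.ofReal ((N x).toReal ^ p) = N x ^ p := fun x => by
    rw [← ENNReal.ofReal_rpow_of_nonneg ENNReal.toReal_nonneg hpq.nonneg,
      ENNReal.ofReal_toReal (hNtop x)]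
  -- Restricting to a finite subfamily serves this point: absorption needs an a priori finite norm.
  have hNfin : ∫⁻ x, N x ^ p ∂σ ≠ ∞ := by
    have hb : ∀ x, N x ^ p ≤ ∑ i ∈ S, (Q i).indicator (fun _ => a i ^ p) x := by
      intro x
      rcases S.eq_empty_or_nonempty with rfl | hS
      · simp [hN, hpq.pos]
      obtain ⟨i, hi, hi'⟩ := Finset.exists_mem_eq_sup S hS
        fun i => (Q i).indicator (fun _ => a i) x
      have : N x ^ p = (Q i).indicator (fun _ => a i ^ p) x := by
        simp only [hN, hi']
        by_cases hx : x ∈ Q i <;> simp [hx, hpq.pos]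
      rw [this]
      exact Finset.single_le_sum (f := fun i => (Q i).indicator (fun _ => a i ^ p) x)
        (fun _ _ => zero_le) hi
    refine ne_top_of_le_ne_top ?_ (lintegral_mono hb)
    rw [lintegral_finsetSum _ fun i _ => measurable_const.indicator (hQ i)]
    refine ENNReal.sum_ne_top.2 fun i _ => ?_
    rw [lintegral_indicator_const (hQ i)]
    exact ENNReal.mul_ne_top (ENNReal.rpow_ne_top_of_nonneg hpq.nonneg (hatop i)) (hσ i)
  have hweak := lintegral_rpow_le_of_weakType hpq σ (M := fun x => (N x).toReal)
    hNm.ennreal_toReal (fun x => ENNReal.toReal_nonneg) hφ (by simpa only [hNp] using hNfin) (by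
      intro t ht
      -- A superlevel set of `N` is a union of members of the family whose average exceeds `t`. On
      -- each of them `t σ ≤ φ σ`, and nesting extends this to the union.
      have hset : {x | t < (N x).toReal} = ⋃ i ∈ S.filter (fun i => ENNReal.ofReal t < a i), Q i := by
        ext x
        rw [mem_ofPred_eq, ← ENNReal.ofReal_lt_iff_lt_toReal ht.le (hNtop x)]
        simp only [hN, Finset.lt_sup_iff, mem_iUnion, Finset.mem_filter, exists_prop]
        constructor
        · rintro ⟨i, hi, h⟩
          by_cases hx : x ∈ Q i
          · exact ⟨i, ⟨hi, by simpa [hx] using h⟩, hx⟩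
          · simp [hx] at h
        · rintro ⟨i, ⟨hi, h⟩, hx⟩
          exact ⟨i, hi, by simpa [hx] using h⟩
      rw [hset]
      have := measure_biUnion_le_of_nested hn hQ (S.filter fun i => ENNReal.ofReal t < a i)
        (ENNReal.ofReal t • σ) (σ.withDensity φ) (by
          intro i hi
          have hi := (Finset.mem_filter.1 hi).2
          rw [withDensity_apply _ (hQ i), Measure.smul_apply, smul_eq_mul]
          exact ENNReal.mul_le_of_le_div hi.le)
      rwa [Measure.smul_apply, smul_eq_mul, withDensity_apply _
        (Finset.measurableSet_biUnion _ fun i _ => hQ i)] at this)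
  simp only [hNp] at hweak
  refine le_trans ?_ hweak
  calc ∑ i ∈ S, a i ^ p * σ (T i) = ∫⁻ x, ∑ i ∈ S, (T i).indicator (fun _ => a i ^ p) x ∂σ := by
        rw [lintegral_finsetSum _ fun i _ => measurable_const.indicator (hT i)]
        exact Finset.sum_congr rfl fun i _ => (lintegral_indicator_const (hT i) _).symm
    _ ≤ ∫⁻ x, N x ^ p ∂σ := by
        refine lintegral_mono fun x => ?_
        by_cases hx : ∃ i ∈ S, x ∈ T i
        · obtain ⟨i, hi, hxi⟩ := hx
          rw [Finset.sum_eq_single_of_mem i hi]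
          · rw [indicator_of_mem hxi]
            refine ENNReal.rpow_le_rpow ?_ hpq.nonneg
            refine le_trans ?_ (Finset.le_sup (f := fun i => (Q i).indicator (fun _ => a i) x) hi)
            simp [hTQ i hxi]
          · intro j _ hj
            exact indicator_of_notMem (fun hxj => (hTd hj).le_bot ⟨hxj, hxi⟩) _
        · push Not at hx
          rw [Finset.sum_eq_zero fun i hi => indicator_of_notMem (hx i hi) _]
          exact zero_le

/-- The numerical inequality behind the sharp weighted bound for sparse forms. -/
theorem sharp_weight_inequality {p q : ℝ} (hpq : p.HolderConjugate q) (hp : 2 ≤ p)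
    {U S UT ST m mT A D : ℝ} (hU : 0 < U) (hS : 0 < S) (hUT : 0 < UT) (hST : 0 < ST) (hm : 0 < m)
    (hA : 0 ≤ A) (hD : 0 ≤ D) (hSTS : ST ≤ S)
    (h1 : mT ≤ UT ^ (1 / p) * ST ^ (1 / q)) (h2 : U ^ (1 / p) * S ^ (1 / q) ≤ A * m)
    (h3 : m ≤ D * mT) :
    S * U / m ≤ D ^ (p - 1) * A ^ p * (ST ^ (1 / p) * UT ^ (1 / q)) := by
  have hp0 := hpq.pos
  have hq0 := hpq.symm.pos
  have hqe : 1 / q = 1 - 1 / p := by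
    have := hpq.inv_add_inv_eq_one
    simp only [one_div]; linarith
  -- Here `U`, `S`, `m` stand for the masses of a box under the weight, the dual weight and the base
  -- measure, and `UT`, `ST`, `mT` for those of its distinguished part.
  have hUS : U * S ^ (p - 1) ≤ A ^ p * m ^ p := by
    have := Real.rpow_le_rpow (by positivity) h2 hp0.le
    rw [Real.mul_rpow (by positivity) (by positivity), Real.mul_rpow hA hm.le,
      ← Real.rpow_mul hU.le, ← Real.rpow_mul hS.le, one_div_mul_cancel hp0.ne', Real.rpow_one,
      hqe] at this
    have e : (1 - 1 / p) * p = p - 1 := by field_simp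
    rwa [e] at this
  have hmp : m ^ (p - 1) ≤ D ^ (p - 1) * (UT ^ (1 / q) * ST ^ ((p - 1) * (1 / q))) := by
    calc m ^ (p - 1) ≤ (D * (UT ^ (1 / p) * ST ^ (1 / q))) ^ (p - 1) :=
          Real.rpow_le_rpow hm.le (h3.trans (by gcongr)) (by linarith)
      _ = D ^ (p - 1) * (UT ^ (1 / q) * ST ^ ((p - 1) * (1 / q))) := by
          rw [Real.mul_rpow hD (by positivity), Real.mul_rpow (by positivity) (by positivity),
            ← Real.rpow_mul hUT.le, ← Real.rpow_mul hST.le]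
          have e : 1 / p * (p - 1) = 1 / q := by rw [hqe]; field_simp
          rw [e, mul_comm (1 / q)]
  -- The place where `p ≥ 2` enters: the exponent is nonpositive, so passing to the smaller set
  -- increases the power.
  have hSp : S ^ (2 - p) ≤ ST ^ (2 - p) :=
    Real.rpow_le_rpow_of_nonpos hST hSTS (by linarith)
  calc S * U / m = (U * S ^ (p - 1)) * S ^ (2 - p) / m := by
        rw [mul_assoc U, ← Real.rpow_add hS]
        have : p - 1 + (2 - p) = 1 := by ring
        rw [this, Real.rpow_one, mul_comm]
    _ ≤ (A ^ p * m ^ p) * ST ^ (2 - p) / m := by gcongr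
    _ = A ^ p * m ^ (p - 1) * ST ^ (2 - p) := by
        rw [Real.rpow_sub hm, Real.rpow_one]; ring
    _ ≤ A ^ p * (D ^ (p - 1) * (UT ^ (1 / q) * ST ^ ((p - 1) * (1 / q)))) * ST ^ (2 - p) := by
        gcongr
    _ = D ^ (p - 1) * A ^ p * ((ST ^ ((p - 1) * (1 / q)) * ST ^ (2 - p)) * UT ^ (1 / q)) := by ring
    _ = _ := by
        rw [← Real.rpow_add hST]
        congr 4
        rw [hqe]; field_simp; ring

/-- The sharp weighted estimate for a sparse form, for exponents at least two. -/
theorem sparse_form_le_of_two_le {p q : ℝ} (hpq : p.HolderConjugate q) (hp : 2 ≤ p)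
    {Q T : ι → Set X} (hn : NestedFamily Q) (hQ : ∀ i, MeasurableSet (Q i))
    (hT : ∀ i, MeasurableSet (T i)) (hTQ : ∀ i, T i ⊆ Q i)
    (hTd : Pairwise fun i j => Disjoint (T i) (T j)) {μ U S : Measure X}
    (hμ0 : ∀ i, μ (Q i) ≠ 0) (hμ : ∀ i, μ (Q i) ≠ ∞) (hU : ∀ i, U (Q i) ≠ ∞)
    (hS : ∀ i, S (Q i) ≠ ∞) {A D : ℝ≥0}
    (h1 : ∀ i, μ (T i) ≤ U (T i) ^ (1 / p) * S (T i) ^ (1 / q))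
    (h2 : ∀ i, U (Q i) ^ (1 / p) * S (Q i) ^ (1 / q) ≤ A * μ (Q i))
    (h3 : ∀ i, μ (Q i) ≤ D * μ (T i))
    {φ ψ : X → ℝ≥0∞} (hφ : Measurable φ) (hψ : Measurable ψ) :
    ∑' i, (∫⁻ x in Q i, φ x ∂S) * (∫⁻ x in Q i, ψ x ∂U) / μ (Q i)
      ≤ ENNReal.ofReal (p * q) * (D : ℝ≥0∞) ^ (p - 1) * (A : ℝ≥0∞) ^ p *
        ((∫⁻ x, φ x ^ p ∂S) ^ (1 / p) * (∫⁻ x, ψ x ^ q ∂U) ^ (1 / q)) := by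
  rw [ENNReal.tsum_eq_iSup_sum]
  refine iSup_le fun F => ?_
  have hT0 : ∀ i, μ (T i) ≠ 0 := fun i h0 => hμ0 i <| by simpa [h0] using h3 i
  have hUS0 : ∀ i, U (T i) ≠ 0 ∧ S (T i) ≠ 0 := by
    intro i
    constructor <;> intro h0 <;> refine hT0 i ?_ <;> have := h1 i <;>
      simpa [h0, hpq.pos, hpq.symm.pos] using this
  have hnum : ∀ i, S (Q i) * U (Q i) / μ (Q i)
      ≤ (D : ℝ≥0∞) ^ (p - 1) * (A : ℝ≥0∞) ^ p * (S (T i) ^ (1 / p) * U (T i) ^ (1 / q)) := by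
    intro i
    have hm := measure_mono (μ := μ) (hTQ i)
    have hm' := measure_mono (μ := U) (hTQ i)
    have hm'' := measure_mono (μ := S) (hTQ i)
    have hle := ENNReal.toNNReal_mono (hS i) hm''
    have hTi := ne_top_of_le_ne_top (hμ i) hm
    have hUTi := ne_top_of_le_ne_top (hU i) hm'
    have hSTi := ne_top_of_le_ne_top (hS i) hm''
    have hUQ0 := ne_of_gt (lt_of_lt_of_le (pos_iff_ne_zero.2 (hUS0 i).1) hm')
    have hSQ0 := ne_of_gt (lt_of_lt_of_le (pos_iff_ne_zero.2 (hUS0 i).2) hm'')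
    have h1 := h1 i
    have h2 := h2 i
    have h3 := h3 i
    have t0 := hT0 i
    have t1 := (hUS0 i).1
    have t2 := (hUS0 i).2
    have t3 := hμ0 i
    rw [← ENNReal.coe_toNNReal (hμ i), ← ENNReal.coe_toNNReal (hU i),
      ← ENNReal.coe_toNNReal (hS i)] at *
    rw [← ENNReal.coe_toNNReal hTi, ← ENNReal.coe_toNNReal hUTi,
      ← ENNReal.coe_toNNReal hSTi] at *
    generalize (μ (Q i)).toNNReal = m at *
    generalize (U (Q i)).toNNReal = u at *
    generalize (S (Q i)).toNNReal = s at *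
    generalize (μ (T i)).toNNReal = m' at *
    generalize (U (T i)).toNNReal = u' at *
    generalize (S (T i)).toNNReal = s' at *
    have ip := hpq.one_div_nonneg
    have iq := hpq.symm.one_div_nonneg
    have hp1 : 0 ≤ p - 1 := by linarith
    simp only [ENNReal.coe_ne_zero] at t0 t1 t2 t3 hUQ0 hSQ0
    rw [← ENNReal.coe_rpow_of_nonneg _ ip, ← ENNReal.coe_rpow_of_nonneg _ iq] at *
    rw [← ENNReal.coe_rpow_of_nonneg _ hp1, ← ENNReal.coe_rpow_of_nonneg _ hpq.nonneg,
      ← ENNReal.coe_mul, ← ENNReal.coe_mul, ← ENNReal.coe_mul, ← ENNReal.coe_mul,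
      ← ENNReal.coe_div t3, ENNReal.coe_le_coe, ← NNReal.coe_le_coe]
    norm_cast at h1 h2 h3
    have := sharp_weight_inequality hpq hp (U := u) (S := s) (UT := u') (ST := s') (m := m)
      (mT := m') (A := A) (D := D)
      (by positivity) (by positivity) (by positivity) (by positivity) (by positivity)
      (by positivity) (by positivity) (by exact_mod_cast hle)
      (by exact_mod_cast h1) (by exact_mod_cast h2) (by exact_mod_cast h3)
    exact_mod_cast this
  -- Averages with respect to the weighted measures themselves, so that the Carleson embedding
  -- applies with a constant blind to the weights.
  set a : ι → ℝ≥0∞ := fun i => (∫⁻ x in Q i, φ x ∂S) / S (Q i) with ha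
  set b : ι → ℝ≥0∞ := fun i => (∫⁻ x in Q i, ψ x ∂U) / U (Q i) with hb
  set K : ℝ≥0∞ := (D : ℝ≥0∞) ^ (p - 1) * (A : ℝ≥0∞) ^ p with hK
  have hterm : ∀ i, (∫⁻ x in Q i, φ x ∂S) * (∫⁻ x in Q i, ψ x ∂U) / μ (Q i)
      ≤ K * ((a i * S (T i) ^ (1 / p)) * (b i * U (T i) ^ (1 / q))) := by
    intro i
    have hS0 : S (Q i) ≠ 0 := fun h0 => (hUS0 i).2 (measure_mono_null (hTQ i) h0)
    have hU0 : U (Q i) ≠ 0 := fun h0 => (hUS0 i).1 (measure_mono_null (hTQ i) h0)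
    calc (∫⁻ x in Q i, φ x ∂S) * (∫⁻ x in Q i, ψ x ∂U) / μ (Q i)
        = (a i * b i) * (S (Q i) * U (Q i) / μ (Q i)) := by
          have e1 : ∫⁻ x in Q i, φ x ∂S = a i * S (Q i) :=
            (ENNReal.div_mul_cancel hS0 (hS i)).symm
          have e2 : ∫⁻ x in Q i, ψ x ∂U = b i * U (Q i) :=
            (ENNReal.div_mul_cancel hU0 (hU i)).symm
          rw [e1, e2, mul_mul_mul_comm, mul_div_assoc]
      _ ≤ (a i * b i) * (K * (S (T i) ^ (1 / p) * U (T i) ^ (1 / q))) := by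
          gcongr; exact hnum i
      _ = _ := by ring
  calc ∑ i ∈ F, (∫⁻ x in Q i, φ x ∂S) * (∫⁻ x in Q i, ψ x ∂U) / μ (Q i)
      ≤ ∑ i ∈ F, K * ((a i * S (T i) ^ (1 / p)) * (b i * U (T i) ^ (1 / q))) :=
        Finset.sum_le_sum fun i _ => hterm i
    _ ≤ K * ((∑ i ∈ F, (a i * S (T i) ^ (1 / p)) ^ p) ^ (1 / p) *
          (∑ i ∈ F, (b i * U (T i) ^ (1 / q)) ^ q) ^ (1 / q)) := by
        rw [← Finset.mul_sum]
        gcongr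
        exact ENNReal.inner_le_Lp_mul_Lq F _ _ hpq
    _ ≤ K * ((ENNReal.ofReal q ^ p * ∫⁻ x, φ x ^ p ∂S) ^ (1 / p) *
          (ENNReal.ofReal p ^ q * ∫⁻ x, ψ x ^ q ∂U) ^ (1 / q)) := by
        have i1 := sum_average_rpow_mul_measure_le hpq S hn hQ hT hTQ hTd hS hφ F
        have i2 := sum_average_rpow_mul_measure_le hpq.symm U hn hQ hT hTQ hTd hU hψ F
        have e1 : ∀ i, (a i * S (T i) ^ (1 / p)) ^ p = a i ^ p * S (T i) := fun i => by
          rw [ENNReal.mul_rpow_of_nonneg _ _ hpq.nonneg, ← ENNReal.rpow_mul,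
            one_div_mul_cancel hpq.ne_zero, ENNReal.rpow_one]
        have e2 : ∀ i, (b i * U (T i) ^ (1 / q)) ^ q = b i ^ q * U (T i) := fun i => by
          rw [ENNReal.mul_rpow_of_nonneg _ _ hpq.symm.nonneg, ← ENNReal.rpow_mul,
            one_div_mul_cancel hpq.symm.ne_zero, ENNReal.rpow_one]
        simp only [e1, e2]
        have := hpq.one_div_nonneg
        have := hpq.symm.one_div_nonneg
        gcongr
    _ = _ := by
        rw [ENNReal.mul_rpow_of_nonneg _ _ hpq.one_div_nonneg,
          ENNReal.mul_rpow_of_nonneg _ _ hpq.symm.one_div_nonneg, ← ENNReal.rpow_mul,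
          ← ENNReal.rpow_mul, mul_one_div_cancel hpq.ne_zero,
          mul_one_div_cancel hpq.symm.ne_zero, ENNReal.rpow_one, ENNReal.rpow_one,
          ENNReal.ofReal_mul hpq.nonneg]
        ring

/-- The sharp weighted estimate for a sparse form. -/
theorem sparse_form_le {p q : ℝ} (hpq : p.HolderConjugate q)
    {Q T : ι → Set X} (hn : NestedFamily Q) (hQ : ∀ i, MeasurableSet (Q i))
    (hT : ∀ i, MeasurableSet (T i)) (hTQ : ∀ i, T i ⊆ Q i)
    (hTd : Pairwise fun i j => Disjoint (T i) (T j)) {μ U S : Measure X}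
    (hμ0 : ∀ i, μ (Q i) ≠ 0) (hμ : ∀ i, μ (Q i) ≠ ∞) (hU : ∀ i, U (Q i) ≠ ∞)
    (hS : ∀ i, S (Q i) ≠ ∞) {A D : ℝ≥0}
    (h1 : ∀ i, μ (T i) ≤ U (T i) ^ (1 / p) * S (T i) ^ (1 / q))
    (h2 : ∀ i, U (Q i) ^ (1 / p) * S (Q i) ^ (1 / q) ≤ A * μ (Q i))
    (h3 : ∀ i, μ (Q i) ≤ D * μ (T i))
    {φ ψ : X → ℝ≥0∞} (hφ : Measurable φ) (hψ : Measurable ψ) :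
    ∑' i, (∫⁻ x in Q i, φ x ∂S) * (∫⁻ x in Q i, ψ x ∂U) / μ (Q i)
      ≤ ENNReal.ofReal (p * q) * (D : ℝ≥0∞) ^ (max p q - 1) * (A : ℝ≥0∞) ^ max p q *
        ((∫⁻ x, φ x ^ p ∂S) ^ (1 / p) * (∫⁻ x, ψ x ^ q ∂U) ^ (1 / q)) := by
  have hadd := hpq.mul_eq_add
  have hp1 := hpq.lt
  have hq1 := hpq.symm.lt
  -- The larger of two conjugate exponents is at least two, and the form is unchanged when `(p, S,
  -- φ)` and `(q, U, ψ)` are exchanged.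
  rcases le_total q p with h | h
  · rw [max_eq_left h]
    exact sparse_form_le_of_two_le hpq (by nlinarith) hn hQ hT hTQ hTd hμ0 hμ hU hS h1 h2 h3 hφ hψ
  · rw [max_eq_right h, mul_comm p q]
    have := sparse_form_le_of_two_le hpq.symm (by nlinarith) hn hQ hT hTQ hTd hμ0 hμ hS hU
      (fun i => by rw [mul_comm]; exact h1 i) (fun i => by rw [mul_comm]; exact h2 i) h3 hψ hφ
    simpa only [mul_comm (∫⁻ x in Q _, ψ x ∂U), mul_comm ((∫⁻ x, ψ x ^ q ∂U) ^ (1 / q))] using this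

/-- Duality for nonnegative functions: a bound for all pairings bounds the `L^p` norm. -/
theorem lintegral_rpow_le_of_pairing {p q : ℝ} (hpq : p.HolderConjugate q) {μ : Measure X}
    [SigmaFinite μ] {G : X → ℝ≥0∞} (hG : Measurable G) {C : ℝ≥0∞}
    (h : ∀ b : X → ℝ≥0∞, Measurable b → ∫⁻ x, G x * b x ∂μ ≤ C * (∫⁻ x, b x ^ q ∂μ) ^ (1 / q)) :
    ∫⁻ x, G x ^ p ∂μ ≤ C ^ p := by
  -- Truncation in height and in space makes `∫ Gn ^ p` finite, as absorption requires. The test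
  -- function is `Gn ^ (p - 1)`, and monotone convergence recovers `G`.
  set Gn : ℕ → X → ℝ≥0∞ := fun n => (spanningSets μ n).indicator fun x => min (G x) n with hGn
  have hGnm : ∀ n, Measurable (Gn n) := fun n =>
    (hG.min measurable_const).indicator (measurableSet_spanningSets μ n)
  have hGnle : ∀ n x, Gn n x ≤ G x := fun n x => by
    by_cases hx : x ∈ spanningSets μ n <;> simp [hGn, hx]
  have hmono : ∀ x, Monotone fun n => Gn n x := by
    intro x m n hmn
    by_cases hx : x ∈ spanningSets μ m
    · have hx' := monotone_spanningSets μ hmn hx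
      simp only [hGn, hx, hx', indicator_of_mem]
      gcongr
    · simp [hGn, hx]
  have hsup : ∀ x, ⨆ n, Gn n x = G x := by
    intro x
    refine le_antisymm (iSup_le fun n => hGnle n x) ?_
    refine le_of_forall_lt fun c hc => ?_
    obtain ⟨n, hn⟩ := ENNReal.exists_nat_gt hc.ne_top
    refine lt_of_lt_of_le ?_ (le_iSup _ (max n (spanningSetsIndex μ x)))
    have hx : x ∈ spanningSets μ (max n (spanningSetsIndex μ x)) :=
      monotone_spanningSets μ (le_max_right _ _) (mem_spanningSetsIndex μ x)
    simp only [hGn, hx, indicator_of_mem]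
    refine lt_min hc (hn.trans_le ?_)
    exact_mod_cast le_max_left _ _
  have hbound : ∀ n, ∫⁻ x, Gn n x ^ p ∂μ ≤ C ^ p := by
    intro n
    refine le_rpow_of_le_mul_rpow hpq ?_ ?_
    · have : ∀ x, Gn n x ^ p ≤ (spanningSets μ n).indicator (fun _ => (n : ℝ≥0∞) ^ p) x := by
        intro x
        by_cases hx : x ∈ spanningSets μ n
        · simp only [hGn, hx, indicator_of_mem]
          exact ENNReal.rpow_le_rpow (min_le_right _ _) hpq.nonneg
        · simp [hGn, hx, hpq.pos]
      refine ne_top_of_le_ne_top ?_ (lintegral_mono this)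
      rw [lintegral_indicator_const (measurableSet_spanningSets μ n)]
      exact ENNReal.mul_ne_top (ENNReal.rpow_ne_top_of_nonneg hpq.nonneg (by simp))
        (measure_spanningSets_lt_top μ n).ne
    · have h1 := h (fun x => Gn n x ^ (p - 1)) ((hGnm n).pow_const _)
      have e : ∀ x, (Gn n x ^ (p - 1)) ^ q = Gn n x ^ p := fun x => by
        rw [← ENNReal.rpow_mul]
        congr 1
        have := hpq.mul_eq_add
        linarith
      simp only [e] at h1
      refine le_trans (lintegral_mono fun x => ?_) h1
      have e' : Gn n x ^ p = Gn n x * Gn n x ^ (p - 1) := by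
        nth_rewrite 2 [← ENNReal.rpow_one (Gn n x)]
        rw [← ENNReal.rpow_add_of_nonneg _ _ zero_le_one hpq.sub_one_pos.le]
        congr 1; ring
      change Gn n x ^ p ≤ _
      rw [e']
      gcongr
      exact hGnle n x
  have hlim : ∫⁻ x, G x ^ p ∂μ = ⨆ n, ∫⁻ x, Gn n x ^ p ∂μ := by
    rw [← lintegral_iSup (fun n => (hGnm n).pow_const _)]
    · refine lintegral_congr fun x => ?_
      rw [← hsup x]
      exact (ENNReal.orderIsoRpow p hpq.pos).map_iSup _
    · exact fun m n hmn x => ENNReal.rpow_le_rpow (hmono x hmn) hpq.nonneg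
  rw [hlim]
  exact iSup_le hbound

end Dyadic

/-! ### The weighted measure on the half-plane: Cartesian coordinates and affine changes of
variable. -/

theorem isOpen_halfPlane : IsOpen halfPlane := isOpen_lt continuous_const Complex.continuous_im

theorem measurableSet_halfPlane : MeasurableSet halfPlane := isOpen_halfPlane.measurableSet

theorem ae_V_mem_halfPlane (α : ℝ) : ∀ᵐ z ∂V α, z ∈ halfPlane :=
  (withDensity_absolutelyContinuous _ _).ae_le (ae_restrict_mem measurableSet_halfPlane)

instance instSigmaFiniteV (α : ℝ) : SigmaFinite (V α) := by
  unfold V; infer_instance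

theorem lintegral_V (α : ℝ) {g : ℂ → ℝ≥0∞} :
    ∫⁻ z, g z ∂V α = ∫⁻ z in halfPlane, ENNReal.ofReal (z.im ^ α) * g z := by
  rw [V, lintegral_withDensity_eq_lintegral_mul_non_measurable _ (by fun_prop) (by simp)]
  rfl

theorem aestronglyMeasurable_V (α : ℝ) {f : ℂ → ℂ} (hf : DifferentiableOn ℂ f halfPlane) :
    AEStronglyMeasurable f (V α) :=
  (hf.continuousOn.aestronglyMeasurable measurableSet_halfPlane).mono_ac
    (withDensity_absolutelyContinuous _ _)

/-- The measure `V α` in Cartesian coordinates. -/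
theorem lintegral_V_eq_iterated (α : ℝ) {g : ℂ → ℝ≥0∞} (hg : Measurable g) :
    ∫⁻ z, g z ∂V α =
      ∫⁻ y in Ioi (0 : ℝ), ENNReal.ofReal (y ^ α) * ∫⁻ x : ℝ, g (x + y * Complex.I) := by
  have hm : Measurable (halfPlane.indicator fun z : ℂ => ENNReal.ofReal (z.im ^ α) * g z) :=
    Measurable.indicator (by fun_prop) measurableSet_halfPlane
  rw [lintegral_V, ← lintegral_indicator measurableSet_halfPlane,
    ← Complex.volume_preserving_equiv_real_prod.symm.lintegral_comp hm,
    Measure.volume_eq_prod,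
    lintegral_prod_symm (fun a => (halfPlane.indicator fun z : ℂ =>
      ENNReal.ofReal (z.im ^ α) * g z) (Complex.measurableEquivRealProd.symm a))
      (hm.comp Complex.measurableEquivRealProd.symm.measurable).aemeasurable,
    ← lintegral_indicator measurableSet_Ioi]
  refine lintegral_congr fun y => ?_
  have e : ∀ x : ℝ, Complex.measurableEquivRealProd.symm (x, y) = x + y * Complex.I := fun x => by
    apply Complex.ext <;> simp [Complex.measurableEquivRealProd_symm_apply]
  simp only [e]
  by_cases hy : 0 < y
  · rw [indicator_of_mem (mem_Ioi.2 hy), ← lintegral_const_mul _ (by fun_prop)]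
    refine lintegral_congr fun x => ?_
    rw [indicator_of_mem]
    · simp
    · simp [halfPlane, hy]
  · rw [indicator_of_notMem (by simpa using hy)]
    refine Eq.trans ?_ (lintegral_zero (μ := (volume : Measure ℝ)))
    refine lintegral_congr fun x => ?_
    rw [indicator_of_notMem]
    simpa [halfPlane] using hy

/-- The behaviour of `V α` under affine automorphisms of the half-plane. -/
theorem lintegral_V_affine (α a : ℝ) {b : ℝ} (hb : 0 < b) {g : ℂ → ℝ≥0∞} (hg : Measurable g) :
    ∫⁻ z, g z ∂V α = ENNReal.ofReal (b ^ (2 + α)) * ∫⁻ z, g (a + b * z) ∂V α := by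
  have hm : Measurable (halfPlane.indicator fun z : ℂ => ENNReal.ofReal (z.im ^ α) * g z) :=
    Measurable.indicator (by fun_prop) measurableSet_halfPlane
  rw [lintegral_V, lintegral_V, ← lintegral_indicator measurableSet_halfPlane,
    ← lintegral_indicator measurableSet_halfPlane]
  set G := halfPlane.indicator fun z : ℂ => ENNReal.ofReal (z.im ^ α) * g z with hG
  have h1 : ∫⁻ z, G z = ENNReal.ofReal (b ^ 2) * ∫⁻ z, G (a + b * z) := by
    have hmap := Measure.map_addHaar_smul (volume : Measure ℂ) hb.ne'
    have h2 : ∫⁻ z, G (a + b * z) = ∫⁻ z, G (a + z) ∂(Measure.map (b • ·) volume) := by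
      rw [lintegral_map (by fun_prop) (by fun_prop)]
      simp
    rw [h2, hmap, lintegral_smul_measure, lintegral_add_left_eq_self, smul_eq_mul, ← mul_assoc,
      ← ENNReal.ofReal_mul (by positivity), Complex.finrank_real_complex, abs_of_pos (by positivity),
      mul_inv_cancel₀ (by positivity), ENNReal.ofReal_one, one_mul]
  rw [h1, add_comm 2 α, Real.rpow_add hb, Real.rpow_two, mul_comm (b ^ α),
    ENNReal.ofReal_mul (by positivity), mul_assoc]
  congr 1
  rw [← lintegral_const_mul _ (by
    exact Measurable.indicator (by fun_prop) measurableSet_halfPlane)]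
  refine lintegral_congr fun z => ?_
  by_cases hz : z ∈ halfPlane
  · have hz' : (a + b * z : ℂ) ∈ halfPlane := by
      simp only [halfPlane, mem_ofPred_eq] at hz ⊢
      simpa using mul_pos hb hz
    rw [hG, indicator_of_mem hz', indicator_of_mem hz, ← mul_assoc,
      ← ENNReal.ofReal_mul (by positivity)]
    have hz : 0 < z.im := hz
    congr 2
    rw [← Real.mul_rpow hb.le hz.le]
    simp
  · have hz' : (a + b * z : ℂ) ∉ halfPlane := by
      simp only [halfPlane, mem_ofPred_eq, not_lt] at hz ⊢
      simpa using mul_nonpos_of_nonneg_of_nonpos hb.le hz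
    rw [hG, indicator_of_notMem hz', indicator_of_notMem hz, mul_zero]

theorem wnorm_eq_lintegral {p : ℝ} (hp : 0 < p) (α : ℝ) (h : ℂ → ℂ) :
    wnorm p α h = (∫⁻ z, ‖h z‖ₑ ^ p ∂V α) ^ (1 / p) := by
  rw [wnorm, eLpNorm_eq_lintegral_rpow_enorm_toReal (by simpa using hp) (by simp),
    ENNReal.toReal_ofReal hp.le]

/-! ### The kernel: symmetry, size and `L^p` norms. -/

/-- The constant in the reproducing kernel. -/
def kernelConst (α : ℝ) : ℝ := 2 ^ α * (α + 1) / Real.pi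

theorem kernelConst_pos {α : ℝ} (hα : -1 < α) : 0 < kernelConst α := by
  have : 0 < α + 1 := by linarith
  unfold kernelConst; positivity

theorem norm_kernel {α : ℝ} (hα : -1 < α) (z w : ℂ) :
    ‖kernel α z w‖ = kernelConst α * ‖z - conj w‖ ^ (-(2 + α)) := by
  have e : (-(2 + α : ℝ) : ℂ) = ((-(2 + α) : ℝ) : ℂ) := by push_cast; ring
  have hc : ‖(2 ^ α * (α + 1) / Real.pi : ℝ)‖ = kernelConst α :=
    Real.norm_of_nonneg (kernelConst_pos hα).le
  rw [kernel, norm_mul, e, Complex.norm_cpow_real, Complex.norm_real, hc, norm_div, Complex.norm_I,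
    div_one]

theorem re_sub_conj_div_I {z w : ℂ} : ((z - conj w) / Complex.I).re = z.im + w.im := by
  simp

theorem sub_conj_div_I_mem_slitPlane {z w : ℂ} (hz : z ∈ halfPlane) (hw : w ∈ halfPlane) :
    (z - conj w) / Complex.I ∈ Complex.slitPlane := by
  left
  rw [re_sub_conj_div_I]
  exact add_pos hz hw

theorem conj_kernel (α : ℝ) {z w : ℂ} (hz : z ∈ halfPlane) (hw : w ∈ halfPlane) :
    conj (kernel α z w) = kernel α w z := by
  have h := Complex.slitPlane_arg_ne_pi (sub_conj_div_I_mem_slitPlane hz hw)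
  have e : (w - conj z) / Complex.I = conj ((z - conj w) / Complex.I) := by
    simp [div_eq_mul_inv]
    ring
  rw [kernel, kernel, e, Complex.conj_cpow _ _ h, map_mul, Complex.conj_ofReal, map_neg,
    Complex.conj_ofReal]

theorem measurable_kernel (α : ℝ) : Measurable fun x : ℂ × ℂ => kernel α x.1 x.2 := by
  unfold kernel
  have : Measurable fun x : ℂ × ℂ => (x.1 - conj x.2) / Complex.I := by
    have : Measurable fun x : ℂ × ℂ => conj x.2 := Complex.continuous_conj.measurable.comp measurable_snd
    fun_prop
  fun_prop

theorem differentiableOn_kernel (α : ℝ) {w : ℂ} (hw : w ∈ halfPlane) :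
    DifferentiableOn ℂ (fun z => kernel α z w) halfPlane := by
  intro z hz
  unfold kernel
  refine DifferentiableAt.differentiableWithinAt ?_
  refine DifferentiableAt.const_mul ?_ _
  exact DifferentiableAt.cpow_const (by fun_prop) (sub_conj_div_I_mem_slitPlane hz hw)

theorem norm_sub_conj_pos {z w : ℂ} (hz : z ∈ halfPlane) (hw : w ∈ halfPlane) :
    0 < ‖z - conj w‖ := by
  refine norm_pos_iff.2 fun h => ?_
  have := congrArg Complex.im h
  have hz : 0 < z.im := hz
  have hw : 0 < w.im := hw
  simp at this
  linarith

theorem norm_kernel_pos {α : ℝ} (hα : -1 < α) {z w : ℂ} (hz : z ∈ halfPlane) (hw : w ∈ halfPlane) :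
    0 < ‖kernel α z w‖ := by
  rw [norm_kernel hα]
  exact mul_pos (kernelConst_pos hα) (Real.rpow_pos_of_pos (norm_sub_conj_pos hz hw) _)

theorem kernel_ne_zero {α : ℝ} (hα : -1 < α) {z w : ℂ} (hz : z ∈ halfPlane) (hw : w ∈ halfPlane) :
    kernel α z w ≠ 0 := norm_pos_iff.1 (norm_kernel_pos hα hz hw)

/-- The excess of `t` over `2 + α` is split evenly between the variables. As `|z + i|` dominates
both `(1 + |x|) / 2` and `1 + y`, the integrand is at most a product: the power `-(1 + ε)` is
integrable in `x`, and `-(α + 1 + ε)` is integrable against `y ^ α`, at zero because `α > -1`. -/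
theorem lintegral_rpow_norm_add_I_lt_top {α t : ℝ} (hα : -1 < α) (ht : 2 + α < t) :
    ∫⁻ z, ENNReal.ofReal (‖z + Complex.I‖ ^ (-t)) ∂V α < ∞ := by
  obtain ⟨ε, hε, hte⟩ : ∃ ε : ℝ, 0 < ε ∧ t = (1 + ε) + (α + 1 + ε) :=
    ⟨(t - (2 + α)) / 2, by linarith, by ring⟩
  have hα1 : 0 < α + 1 + ε := by linarith
  rw [lintegral_V_eq_iterated α (by fun_prop)]
  have hpt : ∀ y : ℝ, 0 < y → ∀ x : ℝ, ‖((x + y * Complex.I : ℂ)) + Complex.I‖ ^ (-t)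
      ≤ (2 ^ (1 + ε) * (1 + ‖x‖) ^ (-(1 + ε))) * (1 + y) ^ (-(α + 1 + ε)) := by
    intro y hy x
    have him : 1 + y ≤ ‖((x + y * Complex.I : ℂ)) + Complex.I‖ := by
      have := Complex.abs_im_le_norm ((x + y * Complex.I : ℂ) + Complex.I)
      simp at this
      rw [abs_of_pos (by linarith)] at this
      linarith
    have hre : ‖x‖ ≤ ‖((x + y * Complex.I : ℂ)) + Complex.I‖ := by
      simpa using Complex.abs_re_le_norm ((x + y * Complex.I : ℂ) + Complex.I)
    set R := ‖((x + y * Complex.I : ℂ)) + Complex.I‖ with hR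
    have hR0 : 0 < R := by linarith
    have h2 : (1 + ‖x‖) / 2 ≤ R := by linarith
    have hx0 : 0 < 1 + ‖x‖ := by positivity
    rw [hte, neg_add, Real.rpow_add hR0]
    refine mul_le_mul ?_ ?_ (by positivity) (by positivity)
    · calc R ^ (-(1 + ε)) ≤ ((1 + ‖x‖) / 2) ^ (-(1 + ε)) :=
            Real.rpow_le_rpow_of_nonpos (by positivity) h2 (by linarith)
        _ = _ := by
            rw [Real.div_rpow hx0.le zero_le_two, Real.rpow_neg zero_le_two (1 + ε), div_inv_eq_mul,
              mul_comm]
    · exact Real.rpow_le_rpow_of_nonpos (by linarith) him (by linarith)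
  set A : ℝ≥0∞ := ∫⁻ x : ℝ, ENNReal.ofReal (2 ^ (1 + ε) * (1 + ‖x‖) ^ (-(1 + ε))) with hA
  have hAfin : A < ∞ := by
    have : Integrable (fun x : ℝ => 2 ^ (1 + ε) * (1 + ‖x‖) ^ (-(1 + ε))) :=
      (integrable_one_add_norm (by simp; linarith)).const_mul _
    exact (hasFiniteIntegral_iff_ofReal (Filter.Eventually.of_forall fun x => by positivity)).1
      this.2
  have hB : ∫⁻ y in Ioi (0 : ℝ), ENNReal.ofReal (y ^ α * (1 + y) ^ (-(α + 1 + ε))) < ∞ := by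
    have hint : IntegrableOn (fun y : ℝ => y ^ α * (1 + y) ^ (-(α + 1 + ε))) (Ioi 0) := by
      rw [← Ioc_union_Ioi_eq_Ioi zero_le_one]
      refine IntegrableOn.union ?_ ?_
      · have h1 : IntegrableOn (fun y : ℝ => y ^ α) (Ioc 0 1) :=
          (intervalIntegrable_iff_integrableOn_Ioc_of_le zero_le_one).1
            (intervalIntegral.intervalIntegrable_rpow' hα)
        refine h1.mono' (by fun_prop) ?_
        refine (ae_restrict_mem measurableSet_Ioc).mono fun y hy => ?_
        have hy0 : 0 < y := hy.1
        rw [Real.norm_of_nonneg (by positivity)]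
        refine mul_le_of_le_one_right (by positivity) ?_
        exact Real.rpow_le_one_of_one_le_of_nonpos (by linarith) (by linarith)
      · have h1 : IntegrableOn (fun y : ℝ => y ^ (-(1 + ε))) (Ioi 1) :=
          integrableOn_Ioi_rpow_of_lt (by linarith) one_pos
        refine h1.mono' (by fun_prop) ?_
        refine (ae_restrict_mem measurableSet_Ioi).mono fun y hy => ?_
        have hy0 : 0 < y := zero_lt_one.trans hy
        rw [Real.norm_of_nonneg (by positivity)]
        calc y ^ α * (1 + y) ^ (-(α + 1 + ε)) ≤ y ^ α * y ^ (-(α + 1 + ε)) := by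
              refine mul_le_mul_of_nonneg_left ?_ (by positivity)
              exact Real.rpow_le_rpow_of_nonpos hy0 (by linarith) (by linarith)
          _ = y ^ (-(1 + ε)) := by
              rw [← Real.rpow_add hy0]; congr 1; ring
    refine (hasFiniteIntegral_iff_ofReal ?_).1 hint.2
    refine (ae_restrict_mem measurableSet_Ioi).mono fun y hy => ?_
    have hy0 : 0 < y := hy
    change 0 ≤ y ^ α * (1 + y) ^ (-(α + 1 + ε))
    positivity
  calc _ ≤ ∫⁻ y in Ioi (0 : ℝ), A * ENNReal.ofReal (y ^ α * (1 + y) ^ (-(α + 1 + ε))) := by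
        refine setLIntegral_mono' measurableSet_Ioi fun y hy => ?_
        have hy0 : 0 < y := hy
        rw [ENNReal.ofReal_mul (by positivity), mul_left_comm]
        gcongr
        rw [hA, ← lintegral_mul_const _ (by fun_prop)]
        refine lintegral_mono fun x => ?_
        rw [← ENNReal.ofReal_mul (by positivity)]
        exact ENNReal.ofReal_le_ofReal (hpt y hy0 x)
    _ = A * ∫⁻ y in Ioi (0 : ℝ), ENNReal.ofReal (y ^ α * (1 + y) ^ (-(α + 1 + ε))) :=
        lintegral_const_mul _ (by fun_prop)
    _ < ∞ := ENNReal.mul_lt_top hAfin hB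

/-- The size of the kernel functions in `L^p`. -/
theorem exists_wnorm_kernel_le {α p : ℝ} (hα : -1 < α) (hp : 1 < p) :
    ∃ C : ℝ≥0, ∀ w ∈ halfPlane, wnorm p α (fun z => kernel α z w)
      ≤ C * ENNReal.ofReal (w.im ^ ((2 + α) * (1 / p - 1))) := by
  have hp0 : 0 < p := by linarith
  have hs : 0 < 2 + α := by linarith
  set J : ℝ≥0∞ := ∫⁻ z, ENNReal.ofReal (‖z + Complex.I‖ ^ (-((2 + α) * p))) ∂V α with hJ
  have hJfin : J ≠ ∞ := (lintegral_rpow_norm_add_I_lt_top hα (by nlinarith)).ne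
  have hCfin : ENNReal.ofReal (kernelConst α) * J ^ (1 / p) ≠ ∞ :=
    ENNReal.mul_ne_top ENNReal.ofReal_ne_top
      (ENNReal.rpow_ne_top_of_nonneg (by positivity) hJfin)
  refine ⟨(ENNReal.ofReal (kernelConst α) * J ^ (1 / p)).toNNReal, fun w hw => ?_⟩
  have hw : 0 < w.im := hw
  rw [ENNReal.coe_toNNReal hCfin, wnorm_eq_lintegral hp0]
  have hc := kernelConst_pos hα
  have hm : Measurable fun z : ℂ => ‖kernel α z w‖ₑ ^ p := by
    have := (measurable_kernel α).comp (measurable_id.prodMk (measurable_const (a := w)))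
    exact this.enorm.pow_const _
  have key : ∫⁻ z, ‖kernel α z w‖ₑ ^ p ∂V α = ENNReal.ofReal (kernelConst α) ^ p *
      (ENNReal.ofReal (w.im ^ ((2 + α) * (1 / p - 1))) ^ p * J) := by
    rw [lintegral_V_affine α w.re hw hm, hJ, ← lintegral_const_mul' _ _ ENNReal.ofReal_ne_top,
      ← lintegral_const_mul' (ENNReal.ofReal (w.im ^ ((2 + α) * (1 / p - 1))) ^ p) _
        (ENNReal.rpow_ne_top_of_nonneg hp0.le ENNReal.ofReal_ne_top),
      ← lintegral_const_mul' _ _ (ENNReal.rpow_ne_top_of_nonneg hp0.le ENNReal.ofReal_ne_top)]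
    refine lintegral_congr fun z => ?_
    -- The affine automorphism taking `i` to `w` reduces every kernel norm to the single integral
    -- `J`; only a power of `w.im` depends on `w`.
    have e : (w.re + w.im * z - conj w : ℂ) = w.im * (z + Complex.I) := by
      apply Complex.ext <;> simp; ring
    rw [← ofReal_norm, norm_kernel hα, e, norm_mul, Complex.norm_real,
      Real.norm_of_nonneg hw.le, Real.mul_rpow hw.le (norm_nonneg _),
      ENNReal.ofReal_rpow_of_nonneg (by positivity) hp0.le,
      ENNReal.ofReal_rpow_of_nonneg (by positivity) hp0.le,
      ENNReal.ofReal_rpow_of_nonneg (by positivity) hp0.le,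
      ← ENNReal.ofReal_mul (by positivity), ← ENNReal.ofReal_mul (by positivity),
      ← ENNReal.ofReal_mul (by positivity)]
    congr 1
    rw [Real.mul_rpow hc.le (by positivity), Real.mul_rpow (by positivity) (by positivity),
      ← Real.rpow_mul hw.le, ← Real.rpow_mul (norm_nonneg _), ← Real.rpow_mul hw.le]
    have e2 : w.im ^ (2 + α) * w.im ^ (-(2 + α) * p) = w.im ^ ((2 + α) * (1 / p - 1) * p) := by
      rw [← Real.rpow_add hw]
      congr 1
      field_simp
      ring
    rw [← e2, neg_mul]
    ring
  rw [key, ENNReal.mul_rpow_of_nonneg _ _ (by positivity),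
    ENNReal.mul_rpow_of_nonneg _ _ (by positivity), ← ENNReal.rpow_mul, ← ENNReal.rpow_mul,
    mul_one_div_cancel hp0.ne', ENNReal.rpow_one, ENNReal.rpow_one]
  exact le_of_eq (by ring)

/-! ### The reproducing formula: the mean value property in the disc, carried over by a Cayley map.
-/

theorem abs_det_mul_complex (a : ℂ) :
    |((ContinuousLinearMap.toSpanSingleton ℂ a).restrictScalars ℝ : ℂ →L[ℝ] ℂ).det| = ‖a‖ ^ 2 := by
  have e : (((ContinuousLinearMap.toSpanSingleton ℂ a).restrictScalars ℝ : ℂ →L[ℝ] ℂ) : ℂ →ₗ[ℝ] ℂ)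
      = Algebra.lmul ℝ ℂ a := by
    ext z
    simp [mul_comm]
  rw [ContinuousLinearMap.det, e]
  have := Algebra.norm_complex_apply a
  rw [Algebra.norm_apply] at this
  rw [this, Complex.normSq_eq_norm_sq, abs_of_nonneg (by positivity)]

theorem measurable_indicator_of_continuousOn {f : ℂ → ℂ} {s : Set ℂ} (hf : ContinuousOn f s)
    (hs : MeasurableSet s) : Measurable (s.indicator f) := by
  classical
  rw [← piecewise_eq_indicator]
  exact hf.measurable_piecewise continuousOn_const hs

theorem integral_mul_one_sub_sq_rpow {α : ℝ} (hα : -1 < α) :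
    ∫ r in Ioo (0 : ℝ) 1, r * (1 - r ^ 2) ^ α = 1 / (2 * (α + 1)) := by
  have hα1 : 0 < α + 1 := by linarith
  set A : ℝ → ℝ := fun r => -((1 - r ^ 2) ^ (α + 1)) / (2 * (α + 1)) with hA
  have hcont : ContinuousOn A (Icc 0 1) := by
    have : Continuous fun r : ℝ => (1 - r ^ 2) ^ (α + 1) :=
      (by fun_prop : Continuous fun r : ℝ => 1 - r ^ 2).rpow_const fun _ => Or.inr hα1.le
    exact (this.neg.div_const _).continuousOn
  have hder : ∀ r ∈ Ioo (0 : ℝ) 1, HasDerivAt A (r * (1 - r ^ 2) ^ α) r := by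
    intro r hr
    have h1 : 0 < 1 - r ^ 2 := by nlinarith [hr.1, hr.2]
    have h2 : HasDerivAt (fun r : ℝ => 1 - r ^ 2) (-(2 * r)) r := by
      simpa using (hasDerivAt_pow 2 r).const_sub 1
    have h3 := ((h2.rpow_const (p := α + 1) (Or.inl h1.ne')).neg).div_const (2 * (α + 1))
    have e : -(-(2 * r) * (α + 1) * (1 - r ^ 2) ^ (α + 1 - 1)) / (2 * (α + 1))
        = r * (1 - r ^ 2) ^ α := by
      rw [add_sub_cancel_right]
      field_simp
    rw [e] at h3
    exact h3
  have hint : IntervalIntegrable (fun r : ℝ => r * (1 - r ^ 2) ^ α) volume 0 1 := by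
    rw [intervalIntegrable_iff_integrableOn_Ioc_of_le zero_le_one]
    -- For negative `α` the integrand is unbounded near `1`; integrability is automatic for a
    -- nonnegative derivative of a continuous function.
    refine intervalIntegral.integrableOn_deriv_of_nonneg hcont hder fun r hr => ?_
    have h1 : 0 < 1 - r ^ 2 := by nlinarith [hr.1, hr.2]
    have := hr.1
    positivity
  rw [← integral_Ioc_eq_integral_Ioo, ← intervalIntegral.integral_of_le zero_le_one,
    intervalIntegral.integral_eq_sub_of_hasDerivAt_of_le zero_le_one hcont hder hint]
  simp only [hA]
  rw [one_pow, sub_self, Real.zero_rpow hα1.ne', zero_pow two_ne_zero, sub_zero, Real.one_rpow]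
  ring

/-- The mean value property, in the coordinates of `Complex.polarCoord`. -/
theorem integral_circle_eq {G : ℂ → ℂ} (hG : DifferentiableOn ℂ G (Metric.ball 0 1)) {r : ℝ}
    (hr : 0 < r) (hr1 : r < 1) :
    ∫ θ in Ioo (-Real.pi) Real.pi, G (Complex.polarCoord.symm (r, θ)) = 2 * Real.pi * G 0 := by
  have hcl : DiffContOnCl ℂ G (Metric.ball 0 |r|) := by
    rw [abs_of_pos hr]
    refine DifferentiableOn.diffContOnCl ?_
    rw [closure_ball _ hr.ne']
    exact hG.mono (Metric.closedBall_subset_ball hr1)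
  have h1 := hcl.circleAverage
  have hper : Function.Periodic (fun θ => G (circleMap 0 r θ)) (2 * Real.pi) := fun θ => by
    simp only [periodic_circleMap 0 r θ]
  have h2 : ∫ θ in (-Real.pi)..Real.pi, G (circleMap 0 r θ)
      = ∫ θ in (0 : ℝ)..(2 * Real.pi), G (circleMap 0 r θ) := by
    have := hper.intervalIntegral_add_eq (-Real.pi) 0
    rwa [zero_add, show -Real.pi + 2 * Real.pi = Real.pi by ring] at this
  have e : ∀ θ : ℝ, Complex.polarCoord.symm (r, θ) = circleMap 0 r θ := fun θ => by
    rw [Complex.polarCoord_symm_apply, circleMap, Complex.exp_mul_I]; simp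
  simp only [e]
  rw [← integral_Ioc_eq_integral_Ioo, ← intervalIntegral.integral_of_le (by linarith [Real.pi_pos]),
    h2]
  rw [Real.circleAverage] at h1
  rw [← h1, Complex.real_smul, ← mul_assoc]
  push_cast
  rw [mul_inv_cancel₀ (by simp [Real.pi_ne_zero]), one_mul]

/-- The reproducing property of the weighted Bergman space of the disc at the origin. -/
theorem integral_disc_eq {α : ℝ} (hα : -1 < α) {G : ℂ → ℂ}
    (hG : DifferentiableOn ℂ G (Metric.ball 0 1))
    (hint : IntegrableOn (fun u => (((1 - ‖u‖ ^ 2) ^ α : ℝ) : ℂ) * G u) (Metric.ball 0 1)) :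
    ∫ u in Metric.ball (0 : ℂ) 1, (((1 - ‖u‖ ^ 2) ^ α : ℝ) : ℂ) * G u
      = (Real.pi / (α + 1) : ℝ) * G 0 := by
  have hα1 : 0 < α + 1 := by linarith
  set H : ℂ → ℂ := (Metric.ball 0 1).indicator fun u => (((1 - ‖u‖ ^ 2) ^ α : ℝ) : ℂ) * G u with hH
  have hHm : Measurable H := by
    have : H = fun u => (((1 - ‖u‖ ^ 2) ^ α : ℝ) : ℂ) * (Metric.ball 0 1).indicator G u := by
      ext u
      by_cases hu : u ∈ Metric.ball (0 : ℂ) 1 <;> simp [hH, hu]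
    rw [this]
    have := measurable_indicator_of_continuousOn hG.continuousOn Metric.isOpen_ball.measurableSet
    fun_prop
  have hHint : Integrable H := hint.integrable_indicator Metric.isOpen_ball.measurableSet
  have hpm : Measurable fun x : ℝ × ℝ => Complex.polarCoord.symm x := by
    simp only [Complex.polarCoord_symm_apply]
    fun_prop
  -- Absolute integrability survives the passage to polar coordinates, so Fubini applies. On each
  -- circle the weight is constant and `G` averages to `G 0`; only the radial integral remains.
  have hpol : IntegrableOn (fun x : ℝ × ℝ => x.1 • H (Complex.polarCoord.symm x))
      polarCoord.target := by
    refine ⟨(Measurable.smul measurable_fst (hHm.comp hpm)).aestronglyMeasurable, ?_⟩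
    have h1 := Complex.lintegral_comp_polarCoord_symm fun z => ‖H z‖ₑ
    rw [HasFiniteIntegral]
    refine lt_of_le_of_lt (le_of_eq ?_) (h1.trans_lt hHint.2)
    refine setLIntegral_congr_fun (measurableSet_Ioi.prod measurableSet_Ioo) fun x hx => ?_
    have : 0 < x.1 := hx.1
    rw [enorm_smul, smul_eq_mul, Real.enorm_eq_ofReal this.le]
  rw [← integral_indicator Metric.isOpen_ball.measurableSet,
    ← Complex.integral_comp_polarCoord_symm]
  change ∫ x in polarCoord.target, x.1 • H (Complex.polarCoord.symm x) = _
  rw [polarCoord_target] at hpol ⊢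
  rw [Measure.volume_eq_prod] at hpol ⊢
  rw [setIntegral_prod _ hpol]
  have hr : ∀ r ∈ Ioi (0 : ℝ), ∫ θ in Ioo (-Real.pi) Real.pi, r • H (Complex.polarCoord.symm (r, θ))
      = (Ioo (0 : ℝ) 1).indicator (fun r => ((r * (1 - r ^ 2) ^ α : ℝ) : ℂ) * (2 * Real.pi * G 0)) r := by
    intro r hr
    have hr0 : 0 < r := hr
    have hnorm : ∀ θ : ℝ, ‖Complex.polarCoord.symm (r, θ)‖ = r := fun θ => by
      rw [Complex.norm_polarCoord_symm, abs_of_pos hr0]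
    by_cases hr1 : r < 1
    · rw [indicator_of_mem (show r ∈ Ioo (0 : ℝ) 1 from ⟨hr0, hr1⟩),
        ← integral_circle_eq hG hr0 hr1, ← integral_const_mul]
      refine integral_congr_ae (Filter.Eventually.of_forall fun θ => ?_)
      have hmem : Complex.polarCoord.symm (r, θ) ∈ Metric.ball (0 : ℂ) 1 := by
        rw [mem_ball_zero_iff, hnorm]; exact hr1
      simp only [hH]
      rw [indicator_of_mem hmem, hnorm, Complex.real_smul]
      push_cast
      ring
    · rw [indicator_of_notMem (fun h => hr1 h.2)]
      refine Eq.trans (integral_congr_ae (Filter.Eventually.of_forall fun θ => ?_))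
        (integral_zero _ _)
      have hmem : Complex.polarCoord.symm (r, θ) ∉ Metric.ball (0 : ℂ) 1 := by
        rw [mem_ball_zero_iff, hnorm]; exact hr1
      simp only [hH]
      rw [indicator_of_notMem hmem, smul_zero]
  rw [setIntegral_congr_fun measurableSet_Ioi hr, setIntegral_indicator measurableSet_Ioo,
    inter_eq_right.2 Ioo_subset_Ioi_self, integral_mul_const, integral_complex_ofReal,
    integral_mul_one_sub_sq_rpow hα]
  push_cast
  have : (α + 1 : ℂ) ≠ 0 := by exact_mod_cast hα1.ne'
  field_simp

/-- The conformal map of the unit disc onto the half-plane that sends `0` to `w`. -/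
def cayley (w u : ℂ) : ℂ := (w - conj w * u) / (1 - u)

theorem one_sub_re_pos {u : ℂ} (hu : u ∈ Metric.ball (0 : ℂ) 1) : 0 < (1 - u).re := by
  have h1 : ‖u‖ < 1 := by simpa using hu
  have := Complex.re_le_norm u
  simp; linarith

theorem one_sub_ne_zero {u : ℂ} (hu : u ∈ Metric.ball (0 : ℂ) 1) : 1 - u ≠ 0 := fun h => by
  have := one_sub_re_pos hu
  rw [h] at this
  simp at this

theorem cayley_im {w u : ℂ} (hu : u ∈ Metric.ball (0 : ℂ) 1) :
    (cayley w u).im = w.im * (1 - ‖u‖ ^ 2) / ‖1 - u‖ ^ 2 := by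
  have h0 := one_sub_ne_zero hu
  have hn : Complex.normSq (1 - u) ≠ 0 := by simpa using h0
  rw [cayley, Complex.div_im, ← Complex.normSq_eq_norm_sq, ← Complex.normSq_eq_norm_sq]
  field_simp
  simp [Complex.normSq_apply]
  ring

theorem cayley_mem {w u : ℂ} (hw : w ∈ halfPlane) (hu : u ∈ Metric.ball (0 : ℂ) 1) :
    cayley w u ∈ halfPlane := by
  have hw : 0 < w.im := hw
  have h1 : ‖u‖ < 1 := by simpa using hu
  have h0 : 0 < ‖1 - u‖ := norm_pos_iff.2 (one_sub_ne_zero hu)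
  have h2 : 0 < 1 - ‖u‖ ^ 2 := by nlinarith [norm_nonneg u]
  change 0 < (cayley w u).im
  rw [cayley_im hu]
  positivity

theorem sub_conj_cayley {w u : ℂ} (hu : u ∈ Metric.ball (0 : ℂ) 1) :
    (w - conj (cayley w u)) / Complex.I = ((2 * w.im : ℝ) : ℂ) / (1 - conj u) := by
  have h0 : 1 - conj u ≠ 0 := by
    have := (map_ne_zero (starRingEnd ℂ)).2 (one_sub_ne_zero hu)
    simpa using this
  have e : (w - conj w : ℂ) = ((2 * w.im : ℝ) : ℂ) * Complex.I := by
    rw [Complex.sub_conj]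
  rw [cayley, map_div₀, map_sub, map_sub, map_mul, Complex.conj_conj, map_one]
  field_simp
  rw [mul_comm Complex.I, ← e]
  ring

theorem image_cayley {w : ℂ} (hw : w ∈ halfPlane) : cayley w '' Metric.ball 0 1 = halfPlane := by
  apply Subset.antisymm
  · rintro _ ⟨u, hu, rfl⟩
    exact cayley_mem hw hu
  · intro z hz
    have hne : z - conj w ≠ 0 := norm_pos_iff.1 (norm_sub_conj_pos hz hw)
    have hw : 0 < w.im := hw
    have hz : 0 < z.im := hz
    refine ⟨(z - w) / (z - conj w), ?_, ?_⟩
    · rw [mem_ball_zero_iff, norm_div, div_lt_one (norm_pos_iff.2 hne), ← sq_lt_sq₀ (norm_nonneg _)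
        (norm_nonneg _), ← Complex.normSq_eq_norm_sq, ← Complex.normSq_eq_norm_sq,
        Complex.normSq_apply, Complex.normSq_apply]
      simp
      nlinarith [mul_pos hw hz]
    · have e : (1 : ℂ) - (z - w) / (z - conj w) = (w - conj w) / (z - conj w) := by
        field_simp; ring
      have hne' : w - conj w ≠ 0 := by
        rw [Complex.sub_conj]; simp [hw.ne']
      rw [cayley, e]
      field_simp
      ring

theorem injOn_cayley {w : ℂ} (hw : w ∈ halfPlane) : InjOn (cayley w) (Metric.ball 0 1) := by
  intro u hu v hv h
  have h1 := one_sub_ne_zero hu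
  have h2 := one_sub_ne_zero hv
  have hw : 0 < w.im := hw
  have hne' : w - conj w ≠ 0 := by
    rw [Complex.sub_conj]; simp [hw.ne']
  rw [cayley, cayley, div_eq_div_iff h1 h2] at h
  have : (w - conj w) * (u - v) = 0 := by linear_combination h
  rcases mul_eq_zero.1 this with h3 | h3
  · exact absurd h3 hne'
  · exact sub_eq_zero.1 h3

theorem hasDerivAt_cayley (w : ℂ) {u : ℂ} (hu : u ∈ Metric.ball (0 : ℂ) 1) :
    HasDerivAt (cayley w) ((w - conj w) / (1 - u) ^ 2) u := by
  have h1 := one_sub_ne_zero hu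
  have h2 : HasDerivAt (fun u => w - conj w * u) (-(conj w)) u := by
    simpa using ((hasDerivAt_id u).const_mul (conj w)).const_sub w
  have h3 : HasDerivAt (fun u : ℂ => 1 - u) (-1) u := by
    simpa using (hasDerivAt_id u).const_sub 1
  have e : (-(conj w) * (1 - u) - (w - conj w * u) * (-1)) / (1 - u) ^ 2
      = (w - conj w) / (1 - u) ^ 2 := by
    congr 1; ring
  rw [← e]
  exact h2.div h3 h1

theorem ofReal_mul_cpow {r : ℝ} (hr : 0 < r) {z : ℂ} (hz : z ≠ 0) (n : ℂ) :
    ((r : ℂ) * z) ^ n = (r : ℂ) ^ n * z ^ n := by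
  have hr0 : (r : ℂ) ≠ 0 := by exact_mod_cast hr.ne'
  rw [Complex.cpow_def_of_ne_zero (mul_ne_zero hr0 hz), Complex.cpow_def_of_ne_zero hr0,
    Complex.cpow_def_of_ne_zero hz, Complex.log_ofReal_mul hr hz, add_mul, Complex.exp_add,
    Complex.ofReal_log hr.le]

/-- The integrand of the reproducing formula in disc coordinates. -/
theorem kernel_cayley {α : ℝ} {w u F : ℂ} (hw : w ∈ halfPlane)
    (hu : u ∈ Metric.ball (0 : ℂ) 1) :
    ‖(w - conj w) / (1 - u) ^ 2‖ ^ 2 • ((cayley w u).im ^ α • (kernel α w (cayley w u) * F))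
      = ((kernelConst α * 2 ^ (-α) : ℝ) : ℂ) *
        ((((1 - ‖u‖ ^ 2) ^ α : ℝ) : ℂ) * ((1 - u) ^ (-(2 + α : ℝ) : ℂ) * F)) := by
  have hw0 : 0 < w.im := hw
  have h1 : ‖u‖ < 1 := by simpa using hu
  have hne := one_sub_ne_zero hu
  have h0 : 0 < ‖1 - u‖ := norm_pos_iff.2 hne
  have h2 : 0 < 1 - ‖u‖ ^ 2 := by nlinarith [norm_nonneg u]
  have harg : (1 - u).arg ≠ Real.pi := Complex.slitPlane_arg_ne_pi (Or.inl (one_sub_re_pos hu))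
  have hcne : (1 - conj u) ≠ 0 := by
    have := (map_ne_zero (starRingEnd ℂ)).2 hne
    simpa using this
  have hnorm : ‖w - conj w‖ = 2 * w.im := by
    rw [Complex.sub_conj, norm_mul, Complex.norm_I, mul_one, Complex.norm_real,
      Real.norm_of_nonneg (by positivity)]
  set s : ℝ := 2 + α with hs
  have hK : kernel α w (cayley w u) = (kernelConst α : ℂ) * (((2 * w.im) ^ (-s) : ℝ) *
      conj ((1 - u) ^ (s : ℂ))) := by
    have e1 : (1 - conj u) = conj (1 - u) := by simp
    have harg' : (1 - conj u).arg ≠ Real.pi :=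
      Complex.slitPlane_arg_ne_pi (Or.inl (by simpa using one_sub_re_pos hu))
    rw [kernel, sub_conj_cayley hu, div_eq_mul_inv ((2 * w.im : ℝ) : ℂ), ofReal_mul_cpow (by positivity)
      (inv_ne_zero hcne), Complex.inv_cpow _ _ harg', Complex.cpow_neg (1 - conj u), inv_inv, e1,
      Complex.conj_cpow _ _ harg, Complex.conj_ofReal, Complex.ofReal_cpow (by positivity)]
    rw [hs, kernelConst, Complex.ofReal_neg]
  -- The kernel is anti-analytic in its second variable. This identity trades the anti-analytic
  -- power for an analytic one at the cost of `‖1 - u‖ ^ (2 s)`, which the Jacobian and the weight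
  -- cancel exactly because `s = 2 + α`.
  have hcj : conj ((1 - u) ^ (s : ℂ)) = ((‖1 - u‖ ^ (2 * s) : ℝ) : ℂ) * (1 - u) ^ (-(s : ℝ) : ℂ) := by
    have hz0 : (1 - u) ^ (s : ℂ) ≠ 0 := by simp [Complex.cpow_eq_zero_iff, hne]
    rw [Complex.cpow_neg, eq_mul_inv_iff_mul_eq₀ hz0, mul_comm, Complex.mul_conj,
      Complex.normSq_eq_norm_sq, Complex.norm_cpow_real, ← Real.rpow_natCast, ← Real.rpow_mul h0.le]
    congr 2
    push_cast; ring
  rw [cayley_im hu, hK, hcj, norm_div, hnorm, norm_pow]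
  have hreal : ((2 * w.im) / ‖1 - u‖ ^ 2) ^ 2 * (w.im * (1 - ‖u‖ ^ 2) / ‖1 - u‖ ^ 2) ^ α *
      ((2 * w.im) ^ (-s) * ‖1 - u‖ ^ (2 * s)) = 2 ^ (-α) * (1 - ‖u‖ ^ 2) ^ α := by
    have e1 : ‖1 - u‖ ^ (2 * s) = (‖1 - u‖ ^ 2) ^ 2 * (‖1 - u‖ ^ 2) ^ α := by
      rw [← Real.rpow_natCast (‖1 - u‖ ^ 2), ← Real.rpow_add (by positivity),
        ← Real.rpow_natCast, ← Real.rpow_mul h0.le]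
      push_cast
      rw [hs]
    have e2 : (2 * w.im) ^ (-s) = ((2 * w.im) ^ 2)⁻¹ * (2 ^ (-α) * (w.im ^ α)⁻¹) := by
      rw [hs, neg_add, Real.rpow_add (by positivity), Real.rpow_neg (by positivity), Real.rpow_two,
        Real.mul_rpow (by positivity) hw0.le, Real.rpow_neg hw0.le]
    rw [e1, e2, Real.div_rpow (by positivity) (by positivity), Real.mul_rpow hw0.le h2.le]
    field_simp
  simp only [Complex.real_smul]
  rw [show ((kernelConst α * 2 ^ (-α) : ℝ) : ℂ) * ((((1 - ‖u‖ ^ 2) ^ α : ℝ) : ℂ) *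
    ((1 - u) ^ (-(s : ℝ) : ℂ) * F)) = (kernelConst α : ℂ) * ((2 ^ (-α) * (1 - ‖u‖ ^ 2) ^ α : ℝ) : ℂ) *
    ((1 - u) ^ (-(s : ℝ) : ℂ) * F) by push_cast; ring, ← hreal]
  push_cast
  ring

/-- The reproducing formula, for analytic functions whose integral against the kernel converges
absolutely. -/
theorem integral_kernel_mul {α : ℝ} (hα : -1 < α) {F : ℂ → ℂ}
    (hF : DifferentiableOn ℂ F halfPlane) {w : ℂ} (hw : w ∈ halfPlane)
    (hint : Integrable (fun ζ => kernel α w ζ * F ζ) (V α)) :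
    ∫ ζ, kernel α w ζ * F ζ ∂V α = F w := by
  have hα1 : 0 < α + 1 := by linarith
  have hVint : ∫ ζ, kernel α w ζ * F ζ ∂V α
      = ∫ ζ in halfPlane, (ζ.im ^ α) • (kernel α w ζ * F ζ) := by
    have hae : ∀ᵐ z ∂volume.restrict halfPlane, 0 ≤ z.im ^ α :=
      (ae_restrict_mem measurableSet_halfPlane).mono fun z hz => Real.rpow_nonneg (le_of_lt hz) _
    rw [V, integral_withDensity_eq_integral_toReal_smul (by fun_prop) (by simp)]
    refine integral_congr_ae (hae.mono fun z hz => ?_)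
    simp only [ENNReal.toReal_ofReal hz]
  have hVi : IntegrableOn (fun ζ => (ζ.im ^ α) • (kernel α w ζ * F ζ)) halfPlane := by
    have hae : ∀ᵐ z ∂volume.restrict halfPlane, 0 ≤ z.im ^ α :=
      (ae_restrict_mem measurableSet_halfPlane).mono fun z hz => Real.rpow_nonneg (le_of_lt hz) _
    rw [V, integrable_withDensity_iff_integrable_smul' (by fun_prop) (by simp)] at hint
    refine hint.congr (hae.mono fun z hz => ?_)
    simp only [ENNReal.toReal_ofReal hz]
  have hball : MeasurableSet (Metric.ball (0 : ℂ) 1) := Metric.isOpen_ball.measurableSet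
  have hder : ∀ u ∈ Metric.ball (0 : ℂ) 1, HasFDerivWithinAt (cayley w)
      ((ContinuousLinearMap.toSpanSingleton ℂ ((w - conj w) / (1 - u) ^ 2)).restrictScalars ℝ)
      (Metric.ball 0 1) u := fun u hu =>
    ((hasDerivAt_cayley w hu).hasFDerivAt.restrictScalars ℝ).hasFDerivWithinAt
  rw [← image_cayley hw, integrableOn_image_iff_integrableOn_abs_det_fderiv_smul _ hball hder
    (injOn_cayley hw)] at hVi
  rw [hVint, ← image_cayley hw, integral_image_eq_integral_abs_det_fderiv_smul _ hball hder
    (injOn_cayley hw)]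
  simp only [abs_det_mul_complex] at hVi ⊢
  set c : ℂ := ((kernelConst α * 2 ^ (-α) : ℝ) : ℂ) with hc
  have hcpos : 0 < kernelConst α * 2 ^ (-α) := mul_pos (kernelConst_pos hα) (by positivity)
  have hc0 : c ≠ 0 := by rw [hc]; exact_mod_cast hcpos.ne'
  -- In disc coordinates the integrand is a constant times the radial weight times this analytic
  -- function, and `G 0 = F w`. The constant in the kernel is the one that normalizes the disc
  -- integral.
  set G : ℂ → ℂ := fun u => (1 - u) ^ (-(2 + α : ℝ) : ℂ) * F (cayley w u) with hG
  have hGd : DifferentiableOn ℂ G (Metric.ball 0 1) := by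
    intro u hu
    refine DifferentiableWithinAt.mul ?_ ?_
    · exact (DifferentiableAt.cpow_const (by fun_prop)
        (Or.inl (one_sub_re_pos hu))).differentiableWithinAt
    · have h1 : DifferentiableAt ℂ F (cayley w u) :=
        (hF _ (cayley_mem hw hu)).differentiableAt (isOpen_halfPlane.mem_nhds (cayley_mem hw hu))
      exact (h1.comp u (hasDerivAt_cayley w hu).differentiableAt).differentiableWithinAt
  have hVi' : IntegrableOn (fun u => c * ((((1 - ‖u‖ ^ 2) ^ α : ℝ) : ℂ) * G u))
      (Metric.ball 0 1) :=
    hVi.congr_fun (fun u hu => kernel_cayley hw hu) hball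
  have hGi : IntegrableOn (fun u => (((1 - ‖u‖ ^ 2) ^ α : ℝ) : ℂ) * G u) (Metric.ball 0 1) := by
    have := hVi'.const_mul c⁻¹
    simp only [inv_mul_cancel_left₀ hc0] at this
    exact this
  rw [setIntegral_congr_fun hball fun u hu => kernel_cayley hw hu, integral_const_mul,
    integral_disc_eq hα hGd hGi]
  have hG0 : G 0 = F w := by simp [hG, cayley]
  rw [hG0, ← mul_assoc, ← Complex.ofReal_mul]
  have : kernelConst α * 2 ^ (-α) * (Real.pi / (α + 1)) = 1 := by
    rw [kernelConst, Real.rpow_neg zero_le_two]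
    field_simp
  rw [this]
  simp

/-! ### Normalized kernels and the Berezin transform. -/

/-- By the identity theorem on the connected half-plane the zeros form a set with codiscrete
complement, hence a null set. This is what makes `f⁻¹`, with value `0` at the zeros of `f`, a
genuine reciprocal in all integrals. -/
theorem ae_ne_zero (α : ℝ) {f : ℂ → ℂ} (hf : DifferentiableOn ℂ f halfPlane)
    (hf0 : ∃ z ∈ halfPlane, f z ≠ 0) : ∀ᵐ z ∂V α, f z ≠ 0 := by
  obtain ⟨x, hx, hfx⟩ := hf0
  have hconn : IsConnected halfPlane :=
    ⟨⟨x, hx⟩, (convex_halfSpace_im_gt 0).isPreconnected⟩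
  have h1 := (hf.analyticOnNhd isOpen_halfPlane).preimage_zero_mem_codiscreteWithin hfx hx hconn
  exact (withDensity_absolutelyContinuous _ _).ae_le
    (ae_restrict_le_codiscreteWithin measurableSet_halfPlane h1)

theorem measurable_kernel_left (α : ℝ) (w : ℂ) : Measurable fun z => kernel α z w := by
  unfold kernel
  fun_prop

theorem measurable_kernel_right (α : ℝ) (z : ℂ) : Measurable fun w => kernel α z w := by
  unfold kernel
  have : Measurable fun w : ℂ => conj w := Complex.continuous_conj.measurable
  fun_prop

theorem norm_kernel_comm {α : ℝ} (hα : -1 < α) (z w : ℂ) : ‖kernel α z w‖ = ‖kernel α w z‖ := by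
  rw [norm_kernel hα, norm_kernel hα, ← Complex.norm_conj (z - conj w), map_sub, Complex.conj_conj,
    norm_sub_rev]

theorem enorm_kernel_comm {α : ℝ} (hα : -1 < α) (z w : ℂ) :
    ‖kernel α z w‖ₑ = ‖kernel α w z‖ₑ := by
  rw [← ofReal_norm, ← ofReal_norm, norm_kernel_comm hα]

theorem wnorm_kernel_lt_top {α p : ℝ} (hα : -1 < α) (hp : 1 < p) {w : ℂ} (hw : w ∈ halfPlane) :
    wnorm p α (fun z => kernel α z w) < ∞ := by
  obtain ⟨C, hC⟩ := exists_wnorm_kernel_le hα hp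
  exact (hC w hw).trans_lt (ENNReal.mul_lt_top ENNReal.coe_lt_top ENNReal.ofReal_lt_top)

theorem memBergman_kernel {α p : ℝ} (hα : -1 < α) (hp : 1 < p) {w : ℂ} (hw : w ∈ halfPlane) :
    MemBergman p α fun z => kernel α z w :=
  ⟨differentiableOn_kernel α hw, wnorm_kernel_lt_top hα hp hw⟩

theorem norm_kernel_self {α : ℝ} (hα : -1 < α) {w : ℂ} (hw : w ∈ halfPlane) :
    ‖kernel α w w‖ = kernelConst α * (2 * w.im) ^ (-(2 + α)) := by
  have hw : 0 < w.im := hw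
  rw [norm_kernel hα, Complex.sub_conj, norm_mul, Complex.norm_I, mul_one, Complex.norm_real,
    Real.norm_of_nonneg (by positivity)]

/-- The `L^2` norm of a kernel function. -/
theorem wnorm_two_kernel_sq {α : ℝ} (hα : -1 < α) {w : ℂ} (hw : w ∈ halfPlane) :
    wnorm 2 α (fun z => kernel α z w) ^ 2 = ‖kernel α w w‖ₑ := by
  have hfin := wnorm_kernel_lt_top hα one_lt_two hw
  have h2 : wnorm 2 α (fun z => kernel α z w) ^ 2 = ∫⁻ z, ‖kernel α z w‖ₑ ^ 2 ∂V α := by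
    rw [wnorm_eq_lintegral two_pos, ← ENNReal.rpow_natCast, ← ENNReal.rpow_mul]
    norm_num
  have hI : Integrable (fun z => ‖kernel α z w‖ ^ 2) (V α) := by
    refine ⟨((measurable_kernel_left α w).norm.pow_const 2).aestronglyMeasurable, ?_⟩
    rw [HasFiniteIntegral]
    simp only [enorm_pow, enorm_norm]
    rw [← h2]
    exact ENNReal.pow_lt_top hfin
  have hae : (fun z => kernel α w z * kernel α z w) =ᵐ[V α]
      fun z => ((‖kernel α z w‖ ^ 2 : ℝ) : ℂ) := by
    filter_upwards [ae_V_mem_halfPlane α] with z hz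
    rw [← conj_kernel α hz hw, mul_comm, Complex.mul_conj, Complex.normSq_eq_norm_sq]
  -- The kernel function is reproduced at its own pole parameter: the integral of `|K_w|²` equals
  -- `K(w,w)`.
  have h3 := integral_kernel_mul hα (differentiableOn_kernel α hw) hw
    ((hI.ofReal (𝕜 := ℂ)).congr hae.symm)
  rw [integral_congr_ae hae, integral_complex_ofReal] at h3
  rw [h2, ← h3, ← ofReal_norm, Complex.norm_real,
    Real.norm_of_nonneg (integral_nonneg fun z => by positivity),
    ofReal_integral_eq_lintegral_ofReal hI (Filter.Eventually.of_forall fun z => by positivity)]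
  refine lintegral_congr fun z => ?_
  rw [ENNReal.ofReal_pow (norm_nonneg _), ofReal_norm]

/-- The norm `‖K_w‖_{2,α}`. -/
def kernelNorm (α : ℝ) (w : ℂ) : ℝ := (wnorm 2 α fun ζ => kernel α ζ w).toReal

theorem kernelNorm_sq {α : ℝ} (hα : -1 < α) {w : ℂ} (hw : w ∈ halfPlane) :
    kernelNorm α w ^ 2 = ‖kernel α w w‖ := by
  rw [kernelNorm, ← ENNReal.toReal_pow, wnorm_two_kernel_sq hα hw, toReal_enorm]

theorem kernelNorm_pos {α : ℝ} (hα : -1 < α) {w : ℂ} (hw : w ∈ halfPlane) :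
    0 < kernelNorm α w := by
  have h1 : 0 < kernelNorm α w ^ 2 := by
    rw [kernelNorm_sq hα hw]; exact norm_kernel_pos hα hw hw
  have h2 : 0 ≤ kernelNorm α w := ENNReal.toReal_nonneg
  exact lt_of_le_of_ne h2 fun h => by rw [← h] at h1; simp at h1

theorem norm_normKernel (α : ℝ) (w z : ℂ) :
    ‖normKernel α w z‖ = ‖kernel α z w‖ / kernelNorm α w := by
  rw [normKernel, norm_div, Complex.norm_real, Real.norm_of_nonneg ENNReal.toReal_nonneg, kernelNorm]

theorem measurable_normKernel (α : ℝ) (w : ℂ) : Measurable (normKernel α w) :=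
  (measurable_kernel_left α w).div_const _

theorem wnorm_mul_normKernel {α p : ℝ} (hα : -1 < α) {w : ℂ} (hw : w ∈ halfPlane) (f : ℂ → ℂ) :
    wnorm p α (fun z => f z * normKernel α w z)
      = ENNReal.ofReal (kernelNorm α w)⁻¹ * wnorm p α (fun z => f z * kernel α z w) := by
  have hN := kernelNorm_pos hα hw
  have e : (fun z => f z * normKernel α w z)
      = ((kernelNorm α w)⁻¹ : ℂ) • fun z => f z * kernel α z w := by
    ext z
    simp only [normKernel, Pi.smul_apply, smul_eq_mul, kernelNorm]
    ring
  rw [e, wnorm, eLpNorm_const_smul, wnorm]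
  congr 1
  rw [← ofReal_norm, norm_inv, Complex.norm_real, Real.norm_of_nonneg hN.le]

theorem wnorm_mul_kernel {α p : ℝ} (hα : -1 < α) {w : ℂ} (hw : w ∈ halfPlane) (f : ℂ → ℂ) :
    wnorm p α (fun z => f z * kernel α z w)
      = ENNReal.ofReal (kernelNorm α w) * wnorm p α (fun z => f z * normKernel α w z) := by
  have hN := kernelNorm_pos hα hw
  rw [wnorm_mul_normKernel hα hw, ← mul_assoc, ← ENNReal.ofReal_mul hN.le, mul_inv_cancel₀ hN.ne',
    ENNReal.ofReal_one, one_mul]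

/-- The product `‖k_w‖_p ‖k_w‖_q` is bounded. -/
theorem exists_wnorm_normKernel_mul_le {α p q : ℝ} (hα : -1 < α) (hpq : p.HolderConjugate q) :
    ∃ C : ℝ≥0, ∀ w ∈ halfPlane, wnorm p α (normKernel α w) * wnorm q α (normKernel α w) ≤ C := by
  obtain ⟨A, hA⟩ := exists_wnorm_kernel_le hα hpq.lt
  obtain ⟨B, hB⟩ := exists_wnorm_kernel_le hα hpq.symm.lt
  have hc := kernelConst_pos hα
  refine ⟨A * B * Real.toNNReal ((kernelConst α)⁻¹ * 2 ^ (2 + α)), fun w hw => ?_⟩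
  have hw0 : 0 < w.im := hw
  have hN := kernelNorm_pos hα hw
  have e1 := wnorm_mul_normKernel (p := p) hα hw fun _ => 1
  have e2 := wnorm_mul_normKernel (p := q) hα hw fun _ => 1
  simp only [one_mul] at e1 e2
  change wnorm p α (fun z => normKernel α w z) * wnorm q α (fun z => normKernel α w z) ≤ _
  rw [e1, e2]
  calc _ ≤ (ENNReal.ofReal (kernelNorm α w)⁻¹ *
          (A * ENNReal.ofReal (w.im ^ ((2 + α) * (1 / p - 1))))) *
        (ENNReal.ofReal (kernelNorm α w)⁻¹ *
          (B * ENNReal.ofReal (w.im ^ ((2 + α) * (1 / q - 1))))) := by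
        gcongr
        · exact hA w hw
        · exact hB w hw
    _ = A * B * (ENNReal.ofReal ((kernelNorm α w)⁻¹ * (kernelNorm α w)⁻¹ *
          (w.im ^ ((2 + α) * (1 / p - 1)) * w.im ^ ((2 + α) * (1 / q - 1))))) := by
        rw [ENNReal.ofReal_mul (by positivity), ENNReal.ofReal_mul (by positivity),
          ENNReal.ofReal_mul (by positivity)]
        ring
    _ = _ := by
        push_cast
        congr 1
        rw [← ENNReal.ofReal]
        congr 1
        -- The powers of `w.im` from the two conjugate exponents add up to the one in `‖K_w‖²`, so
        -- the quotient does not depend on `w`.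
        have e3 : (2 + α) * (1 / p - 1) + (2 + α) * (1 / q - 1) = -(2 + α) := by
          have := hpq.inv_add_inv_eq_one
          simp only [one_div]
          linear_combination (2 + α) * this
        rw [← Real.rpow_add hw0, e3, ← mul_inv, ← sq, kernelNorm_sq hα hw, norm_kernel_self hα hw,
          Real.mul_rpow zero_le_two hw0.le, Real.rpow_neg zero_le_two, Real.rpow_neg hw0.le]
        field_simp

theorem lintegral_mul_le_wnorm {α p q : ℝ} (hpq : p.HolderConjugate q) {f g : ℂ → ℂ}
    (hf : AEStronglyMeasurable f (V α)) (hg : AEStronglyMeasurable g (V α)) :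
    ∫⁻ z, ‖f z * g z‖ₑ ∂V α ≤ wnorm p α f * wnorm q α g := by
  rw [wnorm_eq_lintegral hpq.pos, wnorm_eq_lintegral hpq.symm.pos]
  simp only [enorm_mul]
  exact ENNReal.lintegral_mul_le_Lp_mul_Lq _ hpq hf.enorm hg.enorm

/-- Values of analytic functions are controlled by the norms against `k_w`, through the Berezin
transform. -/
theorem enorm_mul_le_wnorm_mul_wnorm {α p q : ℝ} (hα : -1 < α) (hpq : p.HolderConjugate q)
    {f g : ℂ → ℂ} (hf : DifferentiableOn ℂ f halfPlane) (hg : DifferentiableOn ℂ g halfPlane)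
    {w : ℂ} (hw : w ∈ halfPlane) :
    ‖f w * g w‖ₑ ≤ wnorm p α (fun z => f z * normKernel α w z) *
      wnorm q α (fun z => g z * normKernel α w z) := by
  set R := wnorm p α (fun z => f z * normKernel α w z) *
      wnorm q α (fun z => g z * normKernel α w z) with hR
  rcases eq_or_ne R ∞ with hRt | hRt
  · rw [hRt]; exact le_top
  have hfm := aestronglyMeasurable_V α hf
  have hgm := aestronglyMeasurable_V α hg
  have hkm : AEStronglyMeasurable (fun z => kernel α z w) (V α) :=
    (measurable_kernel_left α w).aestronglyMeasurable
  have hN := kernelNorm_pos hα hw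
  have hle : ∫⁻ z, ‖kernel α w z * (f z * g z * kernel α z w)‖ₑ ∂V α ≤ ‖kernel α w w‖ₑ * R := by
    have h1 := lintegral_mul_le_wnorm hpq (hfm.mul hkm) (hgm.mul hkm)
    refine le_trans (le_of_eq ?_) (h1.trans (le_of_eq ?_))
    · refine lintegral_congr fun z => ?_
      simp only [enorm_mul, Pi.mul_apply, enorm_kernel_comm hα w z]
      ring
    · have e1 := wnorm_mul_kernel (p := p) hα hw f
      have e2 := wnorm_mul_kernel (p := q) hα hw g
      change wnorm p α (fun z => f z * kernel α z w) * wnorm q α (fun z => g z * kernel α z w) = _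
      rw [e1, e2, hR, ← ofReal_norm, ← kernelNorm_sq hα hw, ENNReal.ofReal_pow hN.le]
      ring
  have hI : Integrable (fun z => kernel α w z * (f z * g z * kernel α z w)) (V α) :=
    ⟨(measurable_kernel_right α w).aestronglyMeasurable.mul ((hfm.mul hgm).mul hkm),
      hle.trans_lt (ENNReal.mul_lt_top enorm_lt_top hRt.lt_top)⟩
  -- Applied to `f g K_w` at `w`, the formula produces `f(w) g(w) K(w,w)`; the same integral is
  -- bounded by Hölder after giving one factor `|K_w|` to each of `f` and `g`.
  have h3 := integral_kernel_mul hα ((hf.mul hg).mul (differentiableOn_kernel α hw)) hw hI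
  have h4 := (enorm_integral_le_lintegral_enorm _).trans hle
  rw [show ∫ z, kernel α w z * (f z * g z * kernel α z w) ∂V α = f w * g w * kernel α w w from h3,
    enorm_mul, mul_comm] at h4
  rwa [ENNReal.mul_le_mul_iff_right (by simpa using kernel_ne_zero hα hw hw) enorm_ne_top] at h4

/-! ### Analyticity of projections. -/

theorem hasDerivAt_kernel (α : ℝ) {z ζ : ℂ} (hz : z ∈ halfPlane) (hζ : ζ ∈ halfPlane) :
    HasDerivAt (fun z => kernel α z ζ)
      (kernel α z ζ * (-(2 + α : ℝ) : ℂ) / (z - conj ζ)) z := by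
  have hne : (z - conj ζ) / Complex.I ≠ 0 :=
    Complex.slitPlane_ne_zero (sub_conj_div_I_mem_slitPlane hz hζ)
  have hne' : z - conj ζ ≠ 0 := norm_pos_iff.1 (norm_sub_conj_pos hz hζ)
  have h1 : HasDerivAt (fun z => (z - conj ζ) / Complex.I) (1 / Complex.I) z :=
    ((hasDerivAt_id z).sub_const _).div_const _
  have h2 := (h1.cpow_const (c := (-(2 + α : ℝ) : ℂ))
    (sub_conj_div_I_mem_slitPlane hz hζ)).const_mul ((2 ^ α * (α + 1) / Real.pi : ℝ) : ℂ)
  refine h2.congr_deriv ?_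
  rw [Complex.cpow_sub _ _ hne, Complex.cpow_one, kernel]
  field_simp

/-- The projection of a function is analytic wherever it is defined by absolutely convergent
integrals. -/
theorem differentiableOn_proj {α : ℝ} (hα : -1 < α) {u : ℂ → ℂ} (hu : AEStronglyMeasurable u (V α))
    (h : ProjDefined α u) : DifferentiableOn ℂ (proj α u) halfPlane := by
  intro z₀ hz₀
  have hy : 0 < z₀.im := hz₀
  have hs : 0 < 2 + α := by linarith
  have hball : ∀ z ∈ Metric.ball z₀ (z₀.im / 2), z ∈ halfPlane := by
    intro z hz
    have h1 := Complex.abs_im_le_norm (z - z₀)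
    have h2 : ‖z - z₀‖ < z₀.im / 2 := by simpa [dist_eq_norm] using hz
    have h3 := (abs_lt.1 (h1.trans_lt h2)).1
    simp only [Complex.sub_im] at h3
    change 0 < z.im
    linarith
  -- On the ball of radius `z₀.im / 2` the distance `|z - conj ζ|` is at least half of `|z₀ - conj
  -- ζ|`. The kernel thus grows by at most `2 ^ (2 + α)`, and the extra factor `|z - conj ζ|⁻¹` from
  -- differentiation is at most `2 / z₀.im`.
  set D : ℝ := 2 ^ (2 + α) * (2 + α) * (2 / z₀.im) with hD
  have key := hasDerivAt_integral_of_dominated_loc_of_deriv_le (μ := V α)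
    (F := fun z ζ => kernel α z ζ * u ζ) (x₀ := z₀) (s := Metric.ball z₀ (z₀.im / 2))
    (F' := fun z ζ => kernel α z ζ * (-(2 + α : ℝ) : ℂ) / (z - conj ζ) * u ζ)
    (bound := fun ζ => D * ‖kernel α z₀ ζ * u ζ‖)
    (Metric.ball_mem_nhds _ (by positivity))
    (Filter.Eventually.of_forall fun z =>
      (measurable_kernel_right α z).aestronglyMeasurable.mul hu) (h z₀ hz₀)
    (by
      refine AEStronglyMeasurable.mul (Measurable.aestronglyMeasurable ?_) hu
      have := measurable_kernel_right α z₀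
      have hc : Measurable fun ζ : ℂ => conj ζ := Complex.continuous_conj.measurable
      fun_prop)
    (by
      filter_upwards [ae_V_mem_halfPlane α] with ζ hζ z hz
      have hzH := hball z hz
      have hζ0 : 0 < ζ.im := hζ
      have hp := norm_sub_conj_pos hzH hζ
      have hp0 := norm_sub_conj_pos hz₀ hζ
      have him : z₀.im ≤ ‖z₀ - conj ζ‖ := by
        have := (le_abs_self _).trans (Complex.abs_im_le_norm (z₀ - conj ζ))
        simp only [Complex.sub_im, Complex.conj_im] at this
        linarith
      have hhalf : ‖z₀ - conj ζ‖ / 2 ≤ ‖z - conj ζ‖ := by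
        have h2 : ‖z - z₀‖ < z₀.im / 2 := by simpa [dist_eq_norm] using hz
        have h3 : ‖z₀ - conj ζ‖ ≤ ‖z - conj ζ‖ + ‖z - z₀‖ := by
          rw [norm_sub_rev z z₀]
          calc ‖z₀ - conj ζ‖ = ‖(z - conj ζ) + (z₀ - z)‖ := by congr 1; ring
            _ ≤ _ := norm_add_le _ _
        linarith
      have hK : ‖kernel α z ζ‖ ≤ 2 ^ (2 + α) * ‖kernel α z₀ ζ‖ := by
        rw [norm_kernel hα, norm_kernel hα]
        have := Real.rpow_le_rpow_of_nonpos (by positivity) hhalf (neg_nonpos.2 hs.le)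
        rw [Real.div_rpow hp0.le zero_le_two, Real.rpow_neg zero_le_two, div_inv_eq_mul] at this
        calc _ ≤ kernelConst α * (‖z₀ - conj ζ‖ ^ (-(2 + α)) * 2 ^ (2 + α)) :=
              mul_le_mul_of_nonneg_left this (kernelConst_pos hα).le
          _ = _ := by ring
      have hinv : ‖z - conj ζ‖⁻¹ ≤ 2 / z₀.im := by
        rw [inv_le_comm₀ hp (by positivity), inv_div]
        linarith
      rw [norm_mul, norm_div, norm_mul, norm_neg, Complex.norm_real, Real.norm_of_nonneg hs.le,
        div_eq_mul_inv, norm_mul, hD]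
      calc _ ≤ (2 ^ (2 + α) * ‖kernel α z₀ ζ‖) * (2 + α) * (2 / z₀.im) * ‖u ζ‖ := by gcongr
        _ = _ := by ring)
    ((h z₀ hz₀).norm.const_mul D)
    (by
      filter_upwards [ae_V_mem_halfPlane α] with ζ hζ z hz
      exact (hasDerivAt_kernel α (hball z hz) hζ).mul_const _)
  exact key.2.differentiableAt.differentiableWithinAt

/-! ### Adjacent dyadic grids and Carleson boxes. -/

/-- The shift of the scale `2 ^ k` in the dyadic grid with parameter `e`; the grids for `e = 0` and
`e = 1` are adjacent. -/
def gridShift (e : ℕ) (k : ℤ) : ℝ := e * ((-1) ^ k / 3)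

/-- The index of the grid interval of length `2 ^ k` that contains `x`. -/
def gridCell (e : ℕ) (k : ℤ) (x : ℝ) : ℤ := ⌊x / 2 ^ k - gridShift e k⌋

/-- The Carleson box over a grid interval. -/
def carlesonBox (e : ℕ) (i : ℤ × ℤ) : Set ℂ :=
  {z | z.im ∈ Ioc (0 : ℝ) (2 ^ i.1) ∧ gridCell e i.1 z.re = i.2}

/-- The upper half of the Carleson box over a grid interval. -/
def upperBox (e : ℕ) (i : ℤ × ℤ) : Set ℂ :=
  {z | z.im ∈ Ioc ((2 : ℝ) ^ (i.1 - 1)) (2 ^ i.1) ∧ gridCell e i.1 z.re = i.2}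

/-- The alternating sign in the shift is chosen for this: `gridShift e k - 2 * gridShift e (k + 1)`
equals `±e`, an integer. A cell at scale `k + 1` is therefore obtained from the one at scale `k` by
an integer translation and halving, so each grid is a refining sequence of partitions. -/
theorem gridCell_succ (e : ℕ) (k : ℤ) {x y : ℝ} (h : gridCell e k x = gridCell e k y) :
    gridCell e (k + 1) x = gridCell e (k + 1) y := by
  obtain ⟨n, hn⟩ : ∃ n : ℤ, gridShift e k - 2 * gridShift e (k + 1) = n := by
    rw [gridShift, gridShift, zpow_add₀ (by norm_num)]
    rcases Int.even_or_odd k with hk | hk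
    · exact ⟨e, by rw [hk.neg_one_zpow]; push_cast; ring⟩
    · exact ⟨-e, by rw [hk.neg_one_zpow]; push_cast; ring⟩
  have key : ∀ t : ℝ, gridCell e (k + 1) t = (gridCell e k t + n) / 2 := by
    intro t
    have h2 : t / 2 ^ (k + 1) - gridShift e (k + 1) = ((t / 2 ^ k - gridShift e k) + n) / (2 : ℕ) := by
      rw [← hn, zpow_add₀ two_ne_zero]
      field_simp
      push_cast
      ring
    rw [gridCell, h2, Int.floor_div_natCast, Int.floor_add_intCast]
    rfl
  rw [key, key, h]

theorem gridCell_of_le (e : ℕ) {j k : ℤ} (hjk : j ≤ k) {x y : ℝ}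
    (h : gridCell e j x = gridCell e j y) : gridCell e k x = gridCell e k y := by
  induction k, hjk using Int.leInduction with
  | base => exact h
  | succ k _ ih => exact gridCell_succ e k ih

theorem nestedFamily_carlesonBox (e : ℕ) : NestedFamily (carlesonBox e) := by
  have key : ∀ i j : ℤ × ℤ, i.1 ≤ j.1 → ¬ Disjoint (carlesonBox e i) (carlesonBox e j) →
      carlesonBox e i ⊆ carlesonBox e j := by
    intro i j hij h z hz
    obtain ⟨w, hw, hw'⟩ := not_disjoint_iff.1 h
    refine ⟨⟨hz.1.1, hz.1.2.trans (zpow_le_zpow_right₀ one_le_two hij)⟩, ?_⟩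
    rw [gridCell_of_le e hij (hz.2.trans hw.2.symm)]
    exact hw'.2
  intro i j
  by_cases hd : Disjoint (carlesonBox e i) (carlesonBox e j)
  · exact Or.inr (Or.inr hd)
  · rcases le_total i.1 j.1 with h | h
    · exact Or.inl (key i j h hd)
    · exact Or.inr (Or.inl (key j i h fun h' => hd h'.symm))

theorem upperBox_subset (e : ℕ) (i : ℤ × ℤ) : upperBox e i ⊆ carlesonBox e i := fun _ hz =>
  ⟨⟨(by positivity : (0 : ℝ) < 2 ^ (i.1 - 1)).trans hz.1.1, hz.1.2⟩, hz.2⟩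

theorem pairwise_disjoint_upperBox (e : ℕ) :
    Pairwise fun i j => Disjoint (upperBox e i) (upperBox e j) := by
  have key : ∀ i j : ℤ × ℤ, ∀ z, z ∈ upperBox e i → z ∈ upperBox e j → i.1 ≤ j.1 := by
    intro i j z hi hj
    have h1 : (2 : ℝ) ^ (i.1 - 1) < 2 ^ j.1 := hi.1.1.trans_le hj.1.2
    have := (zpow_lt_zpow_iff_right₀ one_lt_two).1 h1
    lia
  intro i j hij
  refine disjoint_left.2 fun z hi hj => hij ?_
  have h1 : i.1 = j.1 := le_antisymm (key i j z hi hj) (key j i z hj hi)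
  exact Prod.ext h1 (by rw [← hi.2, ← hj.2, h1])

theorem measurable_gridCell (e : ℕ) (k : ℤ) : Measurable (gridCell e k) := by
  unfold gridCell
  exact Int.measurable_floor.comp (by fun_prop)

theorem measurableSet_strip (e : ℕ) (k m : ℤ) (b c : ℝ) :
    MeasurableSet {z : ℂ | z.im ∈ Ioc b c ∧ gridCell e k z.re = m} :=
  (Complex.measurable_im measurableSet_Ioc).inter
    (((measurable_gridCell e k).comp Complex.measurable_re) (measurableSet_singleton m))

theorem measurableSet_carlesonBox (e : ℕ) (i : ℤ × ℤ) : MeasurableSet (carlesonBox e i) :=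
  measurableSet_strip e i.1 i.2 0 (2 ^ i.1)

theorem measurableSet_upperBox (e : ℕ) (i : ℤ × ℤ) : MeasurableSet (upperBox e i) :=
  measurableSet_strip e i.1 i.2 (2 ^ (i.1 - 1)) (2 ^ i.1)

theorem gridCell_eq_iff (e : ℕ) (k m : ℤ) (x : ℝ) : gridCell e k x = m ↔
    x ∈ Ico (2 ^ k * (m + gridShift e k)) (2 ^ k * (m + gridShift e k) + 2 ^ k) := by
  have hk : (0 : ℝ) < 2 ^ k := by positivity
  rw [gridCell, Int.floor_eq_iff, mem_Ico, le_sub_iff_add_le, le_div_iff₀ hk, sub_lt_iff_lt_add,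
    div_lt_iff₀ hk]
  constructor <;> rintro ⟨h1, h2⟩ <;> constructor <;> linarith

theorem V_strip {α : ℝ} (hα : -1 < α) (e : ℕ) (k m : ℤ) {b c : ℝ} (hb : 0 ≤ b) (hbc : b ≤ c) :
    V α {z : ℂ | z.im ∈ Ioc b c ∧ gridCell e k z.re = m}
      = ENNReal.ofReal (2 ^ k * ((c ^ (α + 1) - b ^ (α + 1)) / (α + 1))) := by
  have hk : (0 : ℝ) < 2 ^ k := by positivity
  have hS := measurableSet_strip e k m b c
  rw [← lintegral_indicator_one hS, lintegral_V_eq_iterated α (measurable_one.indicator hS)]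
  have hinner : ∀ y : ℝ, ∫⁻ x : ℝ, {z : ℂ | z.im ∈ Ioc b c ∧ gridCell e k z.re = m}.indicator
      (1 : ℂ → ℝ≥0∞) (x + y * Complex.I)
        = (Ioc b c).indicator (fun _ => ENNReal.ofReal (2 ^ k)) y := by
    intro y
    have : ∀ x : ℝ, {z : ℂ | z.im ∈ Ioc b c ∧ gridCell e k z.re = m}.indicator
        (1 : ℂ → ℝ≥0∞) (x + y * Complex.I) = (Ioc b c).indicator (fun _ =>
          (Ico (2 ^ k * (m + gridShift e k)) (2 ^ k * (m + gridShift e k) + 2 ^ k)).indicator 1 x) y := by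
      intro x
      by_cases hy : y ∈ Ioc b c
      · rw [indicator_of_mem hy]
        by_cases hx : gridCell e k x = m
        · rw [indicator_of_mem, indicator_of_mem ((gridCell_eq_iff e k m x).1 hx)]
          · rfl
          · simpa using ⟨hy, hx⟩
        · rw [indicator_of_notMem, indicator_of_notMem fun h => hx ((gridCell_eq_iff e k m x).2 h)]
          simpa using fun _ _ => hx
      · rw [indicator_of_notMem hy, indicator_of_notMem]
        simp only [mem_ofPred_eq, not_and]
        intro h
        exact absurd (by simpa using h) hy
    simp only [this]
    by_cases hy : y ∈ Ioc b c
    · simp only [indicator_of_mem hy]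
      rw [lintegral_indicator_one measurableSet_Ico, Real.volume_Ico, add_sub_cancel_left]
    · simp [indicator_of_notMem hy]
  simp only [hinner]
  have e1 : ∀ y : ℝ, ENNReal.ofReal (y ^ α) * (Ioc b c).indicator
      (fun _ => ENNReal.ofReal (2 ^ k)) y
      = (Ioc b c).indicator (fun y => ENNReal.ofReal (2 ^ k) * ENNReal.ofReal (y ^ α)) y := by
    intro y
    by_cases hy : y ∈ Ioc b c
    · simp only [indicator_of_mem hy, mul_comm]
    · simp [indicator_of_notMem hy]
  simp only [e1]
  have hsub : Ioc b c ⊆ Ioi 0 := fun y hy => lt_of_le_of_lt hb hy.1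
  rw [setLIntegral_indicator measurableSet_Ioc, inter_eq_left.2 hsub,
    lintegral_const_mul _ (by fun_prop), ENNReal.ofReal_mul hk.le]
  congr 1
  have hint : IntegrableOn (fun y : ℝ => y ^ α) (Ioc b c) :=
    (intervalIntegrable_iff_integrableOn_Ioc_of_le hbc).1
      (intervalIntegral.intervalIntegrable_rpow' hα)
  rw [← ofReal_integral_eq_lintegral_ofReal hint, ← intervalIntegral.integral_of_le hbc,
    integral_rpow (Or.inl hα)]
  refine (ae_restrict_mem measurableSet_Ioc).mono fun y hy => ?_
  exact Real.rpow_nonneg (hb.trans hy.1.le) _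

theorem V_carlesonBox {α : ℝ} (hα : -1 < α) (e : ℕ) (i : ℤ × ℤ) :
    V α (carlesonBox e i) = ENNReal.ofReal (((2 : ℝ) ^ i.1) ^ (2 + α) / (α + 1)) := by
  have hk : (0 : ℝ) < 2 ^ i.1 := by positivity
  have hα1 : 0 < α + 1 := by linarith
  rw [carlesonBox, V_strip hα e i.1 i.2 le_rfl hk.le, Real.zero_rpow hα1.ne', sub_zero,
    show 2 + α = 1 + (α + 1) by ring, Real.rpow_add hk 1 (α + 1), Real.rpow_one,
    mul_div_assoc]

/-- Sparseness of the boxes: the lower half carries the fraction `2 ^ (-(α + 1))` of the mass, which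
is less than one exactly because `α > -1`. -/
theorem exists_V_carlesonBox_le {α : ℝ} (hα : -1 < α) :
    ∃ D : ℝ≥0, ∀ e i, V α (carlesonBox e i) ≤ D * V α (upperBox e i) := by
  have hα1 : 0 < α + 1 := by linarith
  have h2 : (2 : ℝ) ^ (-(α + 1)) < 1 := Real.rpow_lt_one_of_one_lt_of_neg one_lt_two (by linarith)
  refine ⟨Real.toNNReal (1 - 2 ^ (-(α + 1)))⁻¹, fun e i => ?_⟩
  have hk : (0 : ℝ) < 2 ^ i.1 := by positivity
  have hle : (2 : ℝ) ^ (i.1 - 1) ≤ 2 ^ i.1 := zpow_le_zpow_right₀ one_le_two (by lia)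
  rw [V_carlesonBox hα, upperBox, V_strip hα e i.1 i.2 (by positivity) hle]
  change _ ≤ ENNReal.ofReal _ * _
  have hpos : 0 < 1 - (2 : ℝ) ^ (-(α + 1)) := by linarith
  rw [← ENNReal.ofReal_mul (by positivity)]
  refine ENNReal.ofReal_le_ofReal (le_of_eq ?_)
  rw [zpow_sub_one₀ two_ne_zero, Real.mul_rpow hk.le (by norm_num), Real.inv_rpow zero_le_two,
    ← Real.rpow_neg zero_le_two, show 2 + α = 1 + (α + 1) by ring, Real.rpow_add hk, Real.rpow_one]
  field_simp

/-- Two points at distance less than `2 ^ k / 3` share an interval of length `2 ^ k` in one of the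
two adjacent grids. -/
theorem exists_gridCell_eq (k : ℤ) {x y : ℝ} (h : |x - y| < 2 ^ k / 3) :
    gridCell 0 k x = gridCell 0 k y ∨ gridCell 1 k x = gridCell 1 k y := by
  wlog hxy : x ≤ y generalizing x y
  · rw [eq_comm, eq_comm (a := gridCell 1 k x)]
    exact this (by rwa [abs_sub_comm]) (le_of_not_ge hxy)
  have hk : (0 : ℝ) < 2 ^ k := by positivity
  simp only [gridCell, gridShift]
  set s := x / 2 ^ k with hs
  set t := y / 2 ^ k with ht
  have hst : s ≤ t := by rw [hs, ht]; gcongr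
  have hd : t - s < 1 / 3 := by
    rw [abs_sub_comm, abs_of_nonneg (by linarith)] at h
    rw [hs, ht, ← sub_div, div_lt_iff₀ hk]
    linarith
  by_cases hfl : ⌊s⌋ = ⌊t⌋
  · left; simpa using hfl
  right
  -- The integer `⌊t⌋` separates the points, and both lie within `1 / 3` of it. Shifting both by a
  -- third in either direction puts them on the same side.
  have hlt : ⌊s⌋ < ⌊t⌋ := lt_of_le_of_ne (Int.floor_mono hst) hfl
  have h1 : s < ⌊t⌋ := Int.floor_lt.1 hlt
  have h2 : (⌊t⌋ : ℝ) ≤ t := Int.floor_le t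
  rcases Int.even_or_odd k with hk' | hk'
  · rw [hk'.neg_one_zpow]
    have e1 : ⌊s - ((1 : ℕ) : ℝ) * (1 / 3)⌋ = ⌊t⌋ - 1 := by
      rw [Int.floor_eq_iff]; push_cast; constructor <;> linarith
    have e2 : ⌊t - ((1 : ℕ) : ℝ) * (1 / 3)⌋ = ⌊t⌋ - 1 := by
      rw [Int.floor_eq_iff]; push_cast; constructor <;> linarith
    rw [e1, e2]
  · rw [hk'.neg_one_zpow]
    have e1 : ⌊s - ((1 : ℕ) : ℝ) * (-1 / 3)⌋ = ⌊t⌋ := by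
      rw [Int.floor_eq_iff]; push_cast; constructor <;> linarith
    have e2 : ⌊t - ((1 : ℕ) : ℝ) * (-1 / 3)⌋ = ⌊t⌋ := by
      rw [Int.floor_eq_iff]; push_cast; constructor <;> linarith
    rw [e1, e2]

/-- Every pair of points lies in a common Carleson box of one of the two grids whose measure is
comparable to the reciprocal of the kernel. -/
theorem exists_carlesonBox {α : ℝ} (hα : -1 < α) {z ζ : ℂ} (hz : z ∈ halfPlane)
    (hζ : ζ ∈ halfPlane) : ∃ e ∈ Finset.range 2, ∃ i, z ∈ carlesonBox e i ∧ ζ ∈ carlesonBox e i ∧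
      ‖kernel α z ζ‖ₑ ≤ ENNReal.ofReal (kernelConst α * 6 ^ (2 + α) / (α + 1)) / V α (carlesonBox e i) := by
  have hα1 : 0 < α + 1 := by linarith
  have hR := norm_sub_conj_pos hz hζ
  have hz0 : 0 < z.im := hz
  have hζ0 : 0 < ζ.im := hζ
  set R := ‖z - conj ζ‖ with hRdef
  -- The scale is chosen with `3 R < 2 ^ k ≤ 6 R`. The lower bound makes the real parts closer than
  -- `2 ^ k / 3` and both heights fit in the box; the upper bound compares the mass of the box with
  -- `R ^ (2 + α)`.
  obtain ⟨n, hn1, hn2⟩ := exists_mem_Ico_zpow (x := 3 * R) (y := (2 : ℝ)) (by positivity) one_lt_two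
  set k := n + 1 with hk
  have hLe : (2 : ℝ) ^ k ≤ 6 * R := by
    rw [hk, zpow_add_one₀ two_ne_zero]; linarith
  have hre : |z.re - ζ.re| ≤ R := by simpa using Complex.abs_re_le_norm (z - conj ζ)
  have him : z.im + ζ.im ≤ R := by
    have := (le_abs_self _).trans (Complex.abs_im_le_norm (z - conj ζ))
    simpa using this
  have hL : (0 : ℝ) < 2 ^ k := by positivity
  have hker : ∀ e m, ‖kernel α z ζ‖ₑ ≤ ENNReal.ofReal (kernelConst α * 6 ^ (2 + α) / (α + 1)) /
      V α (carlesonBox e (k, m)) := by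
    intro e m
    have hc := kernelConst_pos hα
    rw [V_carlesonBox hα, ← ENNReal.ofReal_div_of_pos (by positivity), ← ofReal_norm,
      norm_kernel hα]
    refine ENNReal.ofReal_le_ofReal ?_
    have h1 : ((2 : ℝ) ^ k) ^ (2 + α) ≤ 6 ^ (2 + α) * R ^ (2 + α) := by
      rw [← Real.mul_rpow (by norm_num) hR.le]
      exact Real.rpow_le_rpow hL.le hLe (by linarith)
    rw [div_div_div_cancel_right₀ hα1.ne', Real.rpow_neg hR.le, le_div_iff₀ (by positivity), mul_assoc]
    refine mul_le_mul_of_nonneg_left ?_ hc.le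
    rw [inv_mul_le_iff₀ (by positivity), mul_comm]
    exact h1
  have himz : z.im ∈ Ioc (0 : ℝ) (2 ^ k) := ⟨hz0, by linarith⟩
  have himζ : ζ.im ∈ Ioc (0 : ℝ) (2 ^ k) := ⟨hζ0, by linarith⟩
  rcases exists_gridCell_eq k (x := z.re) (y := ζ.re) (by linarith) with h | h
  · exact ⟨0, by simp, (k, gridCell 0 k z.re), ⟨himz, rfl⟩, ⟨himζ, h.symm⟩, hker _ _⟩
  · exact ⟨1, by simp, (k, gridCell 1 k z.re), ⟨himz, rfl⟩, ⟨himζ, h.symm⟩, hker _ _⟩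

/-! ### Sparse domination and the weighted bound for the maximal Bergman operator. -/

/-- The form of the maximal Bergman operator is dominated by two sparse forms. -/
theorem lintegral_kernel_form_le {α : ℝ} (hα : -1 < α) {a b : ℂ → ℝ≥0∞} (ha : Measurable a)
    (hb : Measurable b) :
    ∫⁻ z, (∫⁻ ζ, ‖kernel α z ζ‖ₑ * a ζ ∂V α) * b z ∂V α
      ≤ ENNReal.ofReal (kernelConst α * 6 ^ (2 + α) / (α + 1)) * ∑ e ∈ Finset.range 2,
        ∑' i, (∫⁻ ζ in carlesonBox e i, a ζ ∂V α) * (∫⁻ z in carlesonBox e i, b z ∂V α) /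
          V α (carlesonBox e i) := by
  set C := ENNReal.ofReal (kernelConst α * 6 ^ (2 + α) / (α + 1)) with hC
  have hpt : ∀ z ∈ halfPlane, ∀ ζ ∈ halfPlane, ‖kernel α z ζ‖ₑ ≤ C * ∑ e ∈ Finset.range 2, ∑' i,
      (carlesonBox e i).indicator 1 z * (carlesonBox e i).indicator 1 ζ / V α (carlesonBox e i) := by
    intro z hz ζ hζ
    -- One box containing both points suffices, as all other terms of the sum are nonnegative.
    obtain ⟨e, he, i, hzi, hζi, hle⟩ := exists_carlesonBox hα hz hζ
    refine hle.trans ?_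
    rw [div_eq_mul_inv]
    gcongr
    refine le_trans ?_ (Finset.single_le_sum (f := fun e => ∑' i, (carlesonBox e i).indicator 1 z *
      (carlesonBox e i).indicator 1 ζ / V α (carlesonBox e i)) (fun _ _ => zero_le) he)
    refine le_trans ?_ (ENNReal.le_tsum i)
    rw [indicator_of_mem hzi, indicator_of_mem hζi]
    simp
  have hm : ∀ e i, Measurable ((carlesonBox e i).indicator (1 : ℂ → ℝ≥0∞)) := fun e i =>
    measurable_one.indicator (measurableSet_carlesonBox e i)
  have hind : ∀ (c : ℂ → ℝ≥0∞) (e : ℕ) (i : ℤ × ℤ), Measurable c →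
      ∫⁻ ζ, (carlesonBox e i).indicator 1 ζ * c ζ ∂V α = ∫⁻ ζ in carlesonBox e i, c ζ ∂V α := by
    intro c e i _
    rw [← lintegral_indicator (measurableSet_carlesonBox e i)]
    refine lintegral_congr fun ζ => ?_
    by_cases h : ζ ∈ carlesonBox e i <;> simp [h]
  have hin : ∀ z ∈ halfPlane, ∫⁻ ζ, ‖kernel α z ζ‖ₑ * a ζ ∂V α ≤ C * ∑ e ∈ Finset.range 2, ∑' i,
      (carlesonBox e i).indicator 1 z * ((∫⁻ ζ in carlesonBox e i, a ζ ∂V α) /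
        V α (carlesonBox e i)) := by
    intro z hz
    calc ∫⁻ ζ, ‖kernel α z ζ‖ₑ * a ζ ∂V α
        ≤ ∫⁻ ζ, C * ∑ e ∈ Finset.range 2, ∑' i, ((carlesonBox e i).indicator 1 z /
            V α (carlesonBox e i)) * ((carlesonBox e i).indicator 1 ζ * a ζ) ∂V α := by
          refine lintegral_mono_ae ?_
          filter_upwards [ae_V_mem_halfPlane α] with ζ hζ
          refine (mul_le_mul_left (hpt z hz ζ hζ) (a ζ)).trans (le_of_eq ?_)
          rw [mul_assoc, Finset.sum_mul]
          congr 1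
          refine Finset.sum_congr rfl fun e _ => ?_
          rw [← ENNReal.tsum_mul_right]
          refine tsum_congr fun i => ?_
          simp only [div_eq_mul_inv]
          ring
      _ = _ := by
          rw [lintegral_const_mul _ (by fun_prop), lintegral_finsetSum _ fun e _ => by fun_prop]
          congr 1
          refine Finset.sum_congr rfl fun e _ => ?_
          rw [lintegral_tsum fun i => by fun_prop]
          refine tsum_congr fun i => ?_
          rw [lintegral_const_mul _ (by fun_prop), hind a e i ha]
          simp only [div_eq_mul_inv]
          ring
  calc ∫⁻ z, (∫⁻ ζ, ‖kernel α z ζ‖ₑ * a ζ ∂V α) * b z ∂V α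
      ≤ ∫⁻ z, C * ∑ e ∈ Finset.range 2, ∑' i, ((∫⁻ ζ in carlesonBox e i, a ζ ∂V α) /
        V α (carlesonBox e i)) * ((carlesonBox e i).indicator 1 z * b z) ∂V α := by
        refine lintegral_mono_ae ?_
        filter_upwards [ae_V_mem_halfPlane α] with z hz
        refine (mul_le_mul_left (hin z hz) (b z)).trans (le_of_eq ?_)
        rw [mul_assoc, Finset.sum_mul]
        congr 1
        refine Finset.sum_congr rfl fun e _ => ?_
        rw [← ENNReal.tsum_mul_right]
        refine tsum_congr fun i => ?_
        ring
    _ = _ := by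
        rw [lintegral_const_mul _ (by fun_prop), lintegral_finsetSum _ fun e _ => by fun_prop]
        congr 1
        refine Finset.sum_congr rfl fun e _ => ?_
        rw [lintegral_tsum fun i => by fun_prop]
        refine tsum_congr fun i => ?_
        rw [lintegral_const_mul _ (by fun_prop), hind b e i hb]
        simp only [div_eq_mul_inv]
        ring

/-- For a box of side `L`, take `w` at height `L` above the left endpoint of its base. Every `z` in
the box has `|z - conj w| ≤ 3 L`, horizontally at most `L` and vertically at most `2 L`, so `|k_w|²`
is bounded below there by `κ²`, a fixed multiple of the reciprocal of the mass. This converts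
conditions on kernels into conditions on boxes. -/
theorem exists_le_norm_normKernel {α : ℝ} (hα : -1 < α) :
    ∃ A : ℝ, 0 < A ∧ ∀ e i, ∃ w ∈ halfPlane, ∃ κ : ℝ, 0 < κ ∧
      (∀ z ∈ carlesonBox e i, κ ≤ ‖normKernel α w z‖) ∧
      ENNReal.ofReal A * V α (carlesonBox e i) = ENNReal.ofReal (κ⁻¹ * κ⁻¹) := by
  have hc := kernelConst_pos hα
  have hα1 : 0 < α + 1 := by linarith
  refine ⟨(kernelConst α)⁻¹ * ((3 ^ (2 + α)) ^ 2 / 2 ^ (2 + α)) * (α + 1), by positivity,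
    fun e i => ?_⟩
  set L : ℝ := 2 ^ i.1 with hL
  have hL0 : 0 < L := by positivity
  set x₀ : ℝ := L * (i.2 + gridShift e i.1) with hx₀
  set w : ℂ := ⟨x₀, L⟩ with hw
  have hwH : w ∈ halfPlane := hL0
  have hN := kernelNorm_pos hα hwH
  refine ⟨w, hwH, kernelConst α * (3 * L) ^ (-(2 + α)) / kernelNorm α w, by positivity, ?_, ?_⟩
  · intro z hz
    rw [norm_normKernel, norm_kernel hα]
    have hzH : z ∈ halfPlane := hz.1.1
    have hz1 : 0 < z.im := hz.1.1
    have hz2 : z.im ≤ L := hz.1.2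
    have hz3 := (gridCell_eq_iff e i.1 i.2 z.re).1 hz.2
    have hle : ‖z - conj w‖ ≤ 3 * L := by
      refine (Complex.norm_le_abs_re_add_abs_im _).trans ?_
      have h1 : |(z - conj w).re| ≤ L := by
        simp only [Complex.sub_re, Complex.conj_re, hw]
        rw [abs_of_nonneg (sub_nonneg.2 hz3.1)]
        linarith [hz3.2]
      have h2 : |(z - conj w).im| ≤ 2 * L := by
        simp only [Complex.sub_im, Complex.conj_im, hw]
        rw [abs_of_nonneg (by linarith)]
        linarith
      linarith
    have := Real.rpow_le_rpow_of_nonpos (norm_sub_conj_pos hzH hwH) hle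
      (by linarith : -(2 + α) ≤ 0)
    gcongr
  · rw [V_carlesonBox hα, ← ENNReal.ofReal_mul (by positivity), ← hL]
    congr 1
    have hN2 := kernelNorm_sq hα hwH
    rw [norm_kernel_self hα hwH] at hN2
    change _ = kernelConst α * (2 * L) ^ (-(2 + α)) at hN2
    rw [← mul_inv, ← sq, div_pow, hN2, mul_pow, Real.rpow_neg (by positivity),
      Real.rpow_neg (by positivity), Real.mul_rpow (by norm_num) hL0.le,
      Real.mul_rpow (by norm_num) hL0.le]
    field_simp

theorem setLIntegral_rpow_le_wnorm {α p κ : ℝ} (hp : 0 < p) (hκ : 0 < κ) {Q : Set ℂ}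
    (hQ : MeasurableSet Q) {w : ℂ}
    (h : ∀ z ∈ Q, κ ≤ ‖normKernel α w z‖) (f : ℂ → ℂ) :
    (∫⁻ z in Q, ‖f z‖ₑ ^ p ∂V α) ^ (1 / p)
      ≤ ENNReal.ofReal κ⁻¹ * wnorm p α fun z => f z * normKernel α w z := by
  have hκt : ENNReal.ofReal κ⁻¹ ^ p ≠ ∞ := ENNReal.rpow_ne_top_of_nonneg hp.le ENNReal.ofReal_ne_top
  have h1 : ∫⁻ z in Q, ‖f z‖ₑ ^ p ∂V α
      ≤ ENNReal.ofReal κ⁻¹ ^ p * ∫⁻ z, ‖f z * normKernel α w z‖ₑ ^ p ∂V α := by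
    rw [← lintegral_const_mul' _ _ hκt]
    refine le_trans (setLIntegral_mono' hQ fun z hz => ?_) (setLIntegral_le_lintegral Q _)
    rw [← ENNReal.mul_rpow_of_nonneg _ _ hp.le]
    refine ENNReal.rpow_le_rpow ?_ hp.le
    rw [← ofReal_norm, ← ofReal_norm, norm_mul, ← ENNReal.ofReal_mul (by positivity)]
    refine ENNReal.ofReal_le_ofReal ?_
    rw [inv_mul_eq_div, le_div_iff₀ hκ]
    exact mul_le_mul_of_nonneg_left (h z hz) (norm_nonneg _)
  rw [wnorm_eq_lintegral hp]
  refine (ENNReal.rpow_le_rpow h1 (by positivity)).trans (le_of_eq ?_)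
  rw [ENNReal.mul_rpow_of_nonneg _ _ (by positivity), ← ENNReal.rpow_mul,
    mul_one_div_cancel hp.ne', ENNReal.rpow_one]

/-- The Békollé–Bonami condition on Carleson boxes. -/
theorem exists_bekolle_le {α p q : ℝ} (hα : -1 < α) (hpq : p.HolderConjugate q) :
    ∃ A : ℝ≥0, ∀ (f : ℂ → ℂ) e i, (∫⁻ z in carlesonBox e i, ‖f z‖ₑ ^ p ∂V α) ^ (1 / p) *
      (∫⁻ z in carlesonBox e i, ‖(f z)⁻¹‖ₑ ^ q ∂V α) ^ (1 / q)
        ≤ A * invariantConst p q α f * V α (carlesonBox e i) := by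
  obtain ⟨A, hA, h⟩ := exists_le_norm_normKernel hα
  refine ⟨A.toNNReal, fun f e i => ?_⟩
  obtain ⟨w, hw, κ, hκ, hle, hV⟩ := h e i
  have hQ := measurableSet_carlesonBox e i
  have h1 := setLIntegral_rpow_le_wnorm hpq.pos hκ hQ hle f
  have h2 := setLIntegral_rpow_le_wnorm hpq.symm.pos hκ hQ hle fun z => (f z)⁻¹
  have h3 : wnorm p α (fun z => f z * normKernel α w z) *
      wnorm q α (fun z => (f z)⁻¹ * normKernel α w z) ≤ invariantConst p q α f :=
    le_iSup₂ (f := fun w (_ : w ∈ halfPlane) => wnorm p α (fun z => f z * normKernel α w z) *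
      wnorm q α (fun z => (f z)⁻¹ * normKernel α w z)) w hw
  change _ ≤ ENNReal.ofReal A * _ * _
  calc _ ≤ (ENNReal.ofReal κ⁻¹ * wnorm p α fun z => f z * normKernel α w z) *
        (ENNReal.ofReal κ⁻¹ * wnorm q α fun z => (f z)⁻¹ * normKernel α w z) := mul_le_mul' h1 h2
    _ = ENNReal.ofReal (κ⁻¹ * κ⁻¹) * (wnorm p α (fun z => f z * normKernel α w z) *
        wnorm q α (fun z => (f z)⁻¹ * normKernel α w z)) := by
        rw [ENNReal.ofReal_mul (by positivity)]; ring
    _ ≤ ENNReal.ofReal (κ⁻¹ * κ⁻¹) * invariantConst p q α f := by gcongr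
    _ = _ := by rw [← hV]; ring

/-- The maximal Bergman operator on `L^p(|f| ^ p)`, with sharp dependence on the weight. -/
theorem exists_lintegral_kernel_rpow_le {α p q : ℝ} (hα : -1 < α) (hpq : p.HolderConjugate q) :
    ∃ C : ℝ≥0, ∀ f : ℂ → ℂ, DifferentiableOn ℂ f halfPlane → (∃ z ∈ halfPlane, f z ≠ 0) →
      invariantConst p q α f < ∞ → ∀ a : ℂ → ℝ≥0∞, Measurable a →
      ∫⁻ z, (‖f z‖ₑ * ∫⁻ ζ, ‖kernel α z ζ‖ₑ * a ζ ∂V α) ^ p ∂V α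
        ≤ (C * invariantConst p q α f ^ max p q *
          (∫⁻ z, (‖f z‖ₑ * a z) ^ p ∂V α) ^ (1 / p)) ^ p := by
  obtain ⟨A, hA⟩ := exists_bekolle_le hα hpq
  obtain ⟨D, hD⟩ := exists_V_carlesonBox_le hα
  have hp0 := hpq.pos
  have hq0 := hpq.symm.pos
  have hmax : 0 ≤ max p q - 1 := by linarith [le_max_left p q, hpq.lt]
  have hmax0 : 0 ≤ max p q := by linarith
  set C₀ : ℝ≥0∞ := ENNReal.ofReal (kernelConst α * 6 ^ (2 + α) / (α + 1)) with hC₀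
  set C₁ : ℝ≥0∞ := ENNReal.ofReal (p * q) * (D : ℝ≥0∞) ^ (max p q - 1) * (A : ℝ≥0∞) ^ max p q with hC₁
  have hC₁t : C₁ ≠ ∞ := ENNReal.mul_ne_top (ENNReal.mul_ne_top ENNReal.ofReal_ne_top
    (ENNReal.rpow_ne_top_of_nonneg hmax ENNReal.coe_ne_top))
    (ENNReal.rpow_ne_top_of_nonneg hmax0 ENNReal.coe_ne_top)
  have hCt : C₀ * (2 * C₁) ≠ ∞ :=
    ENNReal.mul_ne_top ENNReal.ofReal_ne_top (ENNReal.mul_ne_top (by simp) hC₁t)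
  refine ⟨(C₀ * (2 * C₁)).toNNReal, fun f hf hf0 hinv a ha => ?_⟩
  rw [ENNReal.coe_toNNReal hCt]
  set B := invariantConst p q α f with hB
  -- Extension by zero gives a globally measurable weight without changing any integral against `V
  -- α`.
  set F : ℂ → ℂ := halfPlane.indicator f with hF
  have hFm : Measurable F :=
    measurable_indicator_of_continuousOn hf.continuousOn measurableSet_halfPlane
  set v : ℂ → ℝ≥0∞ := fun z => ‖F z‖ₑ with hv
  have hvm : Measurable v := hFm.enorm
  have hvf : ∀ᵐ z ∂V α, v z = ‖f z‖ₑ := by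
    filter_upwards [ae_V_mem_halfPlane α] with z hz
    simp only [hv, hF, indicator_of_mem hz]
  have hvt : ∀ z, v z ≠ ∞ := fun z => enorm_ne_top
  have hv0 : ∀ᵐ z ∂V α, v z ≠ 0 := by
    filter_upwards [hvf, ae_ne_zero α hf hf0] with z h1 h2
    rw [h1]; simpa using h2
  have hvinv : ∀ᵐ z ∂V α, (v z ^ q)⁻¹ = ‖(f z)⁻¹‖ₑ ^ q := by
    filter_upwards [hvf, ae_ne_zero α hf hf0] with z h1 h2
    rw [h1, ← ENNReal.inv_rpow, enorm_inv h2]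
  -- The weight `|f|^p` and its dual `|f|^(-q)`. Hölder bounds the mass of a set from above by
  -- theirs, and the Békollé–Bonami condition is the reverse inequality on boxes.
  set U : Measure ℂ := (V α).withDensity fun z => v z ^ p with hU
  set S : Measure ℂ := (V α).withDensity fun z => (v z ^ q)⁻¹ with hS
  have hum : Measurable fun z => v z ^ p := hvm.pow_const p
  have hsm : Measurable fun z => (v z ^ q)⁻¹ := (hvm.pow_const q).inv
  have hUQ : ∀ {Q : Set ℂ}, MeasurableSet Q → U Q = ∫⁻ z in Q, v z ^ p ∂V α := fun hQ =>
    withDensity_apply _ hQ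
  have hSQ : ∀ {Q : Set ℂ}, MeasurableSet Q → S Q = ∫⁻ z in Q, (v z ^ q)⁻¹ ∂V α := fun hQ =>
    withDensity_apply _ hQ
  have hholder : ∀ {T : Set ℂ}, MeasurableSet T → V α T ≤ U T ^ (1 / p) * S T ^ (1 / q) := by
    intro T hT
    rw [hUQ hT, hSQ hT]
    have h1 := ENNReal.lintegral_mul_le_Lp_mul_Lq ((V α).restrict T) hpq hvm.aemeasurable
      (g := fun z => (v z)⁻¹) hvm.inv.aemeasurable
    simp only [ENNReal.inv_rpow] at h1
    refine le_trans (le_of_eq ?_) h1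
    have : ∫⁻ z in T, (v * fun z => (v z)⁻¹) z ∂V α = ∫⁻ z in T, 1 ∂V α := by
      refine lintegral_congr_ae (ae_restrict_of_ae ?_)
      filter_upwards [hv0] with z hz
      exact ENNReal.mul_inv_cancel hz (hvt z)
    rw [this, setLIntegral_one]
  have hbek : ∀ e i, U (carlesonBox e i) ^ (1 / p) * S (carlesonBox e i) ^ (1 / q)
      ≤ ((A * B.toNNReal : ℝ≥0) : ℝ≥0∞) * V α (carlesonBox e i) := by
    intro e i
    have hQ := measurableSet_carlesonBox e i
    rw [hUQ hQ, hSQ hQ, ENNReal.coe_mul, ENNReal.coe_toNNReal hinv.ne]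
    refine le_trans (le_of_eq ?_) (hA f e i)
    congr 2
    · refine lintegral_congr_ae (ae_restrict_of_ae ?_)
      filter_upwards [hvf] with z hz
      rw [hz]
    · exact lintegral_congr_ae (ae_restrict_of_ae hvinv)
  have hα1 : 0 < α + 1 := by linarith
  have hVQ0 : ∀ e i, V α (carlesonBox e i) ≠ 0 := by
    intro e i
    rw [V_carlesonBox hα, Ne, ENNReal.ofReal_eq_zero, not_le]
    positivity
  have hVQt : ∀ e i, V α (carlesonBox e i) ≠ ∞ := by
    intro e i
    rw [V_carlesonBox hα]; exact ENNReal.ofReal_ne_top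
  have hUSt : ∀ e i, U (carlesonBox e i) ≠ ∞ ∧ S (carlesonBox e i) ≠ ∞ := by
    intro e i
    have h1 := hholder (measurableSet_carlesonBox e i)
    have h2 : U (carlesonBox e i) ^ (1 / p) * S (carlesonBox e i) ^ (1 / q) ≠ ∞ :=
      ne_top_of_le_ne_top (ENNReal.mul_ne_top ENNReal.coe_ne_top (hVQt e i)) (hbek e i)
    -- Nonvanishing of the product excludes the convention `0 * ∞ = 0`, so finiteness of the product
    -- forces finiteness of each factor.
    have h3 : U (carlesonBox e i) ^ (1 / p) * S (carlesonBox e i) ^ (1 / q) ≠ 0 := fun h0 =>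
      hVQ0 e i (le_antisymm (h0 ▸ h1) zero_le)
    have hp1 : 0 < 1 / p := hpq.one_div_pos
    have hq1 : 0 < 1 / q := hpq.symm.one_div_pos
    constructor
    · intro ht
      rw [ht, ENNReal.top_rpow_of_pos hp1, ENNReal.top_mul (right_ne_zero_of_mul h3)] at h2
      exact h2 rfl
    · intro ht
      rw [ht, ENNReal.top_rpow_of_pos hq1, ENNReal.mul_top (left_ne_zero_of_mul h3)] at h2
      exact h2 rfl
  have hpair : ∀ b : ℂ → ℝ≥0∞, Measurable b →
      ∫⁻ z, (v z * ∫⁻ ζ, ‖kernel α z ζ‖ₑ * a ζ ∂V α) * b z ∂V α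
        ≤ C₀ * (2 * C₁) * B ^ max p q * (∫⁻ z, (v z * a z) ^ p ∂V α) ^ (1 / p) *
          (∫⁻ z, b z ^ q ∂V α) ^ (1 / q) := by
    intro b hb
    -- Chosen so that `φ dS = a dV` and `ψ dU = v b dV`. Because `p q = p + q`, the norms become
    -- those of `v a` in `L^p` and of `b` in `L^q`, both unweighted.
    set φ : ℂ → ℝ≥0∞ := fun z => v z ^ q * a z with hφ
    set ψ : ℂ → ℝ≥0∞ := fun z => (v z ^ p)⁻¹ * (v z * b z) with hψ
    have hφm : Measurable φ := (hvm.pow_const q).mul ha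
    have hψm : Measurable ψ := (hvm.pow_const p).inv.mul (hvm.mul hb)
    have hφQ : ∀ e i, ∫⁻ z in carlesonBox e i, φ z ∂S = ∫⁻ z in carlesonBox e i, a z ∂V α := by
      intro e i
      rw [hS, restrict_withDensity (measurableSet_carlesonBox e i),
        lintegral_withDensity_eq_lintegral_mul _ hsm hφm]
      refine lintegral_congr_ae (ae_restrict_of_ae ?_)
      filter_upwards [hv0] with z hz
      simp only [Pi.mul_apply, hφ]
      rw [← mul_assoc, ENNReal.inv_mul_cancel (by simp [ENNReal.rpow_eq_zero_iff, hz, hvt z])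
        (ENNReal.rpow_ne_top_of_nonneg hq0.le (hvt z)), one_mul]
    have hψQ : ∀ e i, ∫⁻ z in carlesonBox e i, ψ z ∂U
        = ∫⁻ z in carlesonBox e i, v z * b z ∂V α := by
      intro e i
      rw [hU, restrict_withDensity (measurableSet_carlesonBox e i),
        lintegral_withDensity_eq_lintegral_mul _ hum hψm]
      refine lintegral_congr_ae (ae_restrict_of_ae ?_)
      filter_upwards [hv0] with z hz
      simp only [Pi.mul_apply, hψ]
      rw [← mul_assoc, ENNReal.mul_inv_cancel (by simp [ENNReal.rpow_eq_zero_iff, hz, hvt z])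
        (ENNReal.rpow_ne_top_of_nonneg hp0.le (hvt z)), one_mul]
    have hφp : ∫⁻ z, φ z ^ p ∂S = ∫⁻ z, (v z * a z) ^ p ∂V α := by
      rw [hS, lintegral_withDensity_eq_lintegral_mul _ hsm (hφm.pow_const p)]
      refine lintegral_congr_ae ?_
      filter_upwards [hv0] with z hz
      simp only [Pi.mul_apply, hφ]
      rw [ENNReal.mul_rpow_of_nonneg _ _ hp0.le, ENNReal.mul_rpow_of_nonneg _ _ hp0.le,
        ← ENNReal.rpow_mul, ← ENNReal.rpow_neg, ← mul_assoc, ← ENNReal.rpow_add _ _ hz (hvt z)]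
      congr 2
      have := hpq.mul_eq_add
      linarith
    have hψq : ∫⁻ z, ψ z ^ q ∂U = ∫⁻ z, b z ^ q ∂V α := by
      rw [hU, lintegral_withDensity_eq_lintegral_mul _ hum (hψm.pow_const q)]
      refine lintegral_congr_ae ?_
      filter_upwards [hv0] with z hz
      simp only [Pi.mul_apply, hψ]
      rw [ENNReal.mul_rpow_of_nonneg _ _ hq0.le, ENNReal.mul_rpow_of_nonneg _ _ hq0.le,
        ← ENNReal.rpow_neg, ← ENNReal.rpow_mul, ← mul_assoc, ← mul_assoc,
        ← ENNReal.rpow_add _ _ hz (hvt z), ← ENNReal.rpow_add _ _ hz (hvt z)]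
      have : p + -p * q + q = 0 := by
        have := hpq.mul_eq_add
        linarith
      rw [this, ENNReal.rpow_zero, one_mul]
    have hsparse : ∀ e, ∑' i, (∫⁻ ζ in carlesonBox e i, a ζ ∂V α) *
        (∫⁻ z in carlesonBox e i, v z * b z ∂V α) / V α (carlesonBox e i)
          ≤ C₁ * B ^ max p q * ((∫⁻ z, (v z * a z) ^ p ∂V α) ^ (1 / p) *
            (∫⁻ z, b z ^ q ∂V α) ^ (1 / q)) := by
      intro e
      have := sparse_form_le hpq (nestedFamily_carlesonBox e) (measurableSet_carlesonBox e)
        (measurableSet_upperBox e) (upperBox_subset e) (pairwise_disjoint_upperBox e)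
        (hVQ0 e) (hVQt e) (fun i => (hUSt e i).1) (fun i => (hUSt e i).2)
        (fun i => hholder (measurableSet_upperBox e i)) (hbek e) (hD e) hφm hψm
      simp only [hφQ, hψQ, hφp, hψq] at this
      refine this.trans (le_of_eq ?_)
      rw [ENNReal.coe_mul, ENNReal.coe_toNNReal hinv.ne, ENNReal.mul_rpow_of_nonneg _ _ hmax0]
      ring
    calc ∫⁻ z, (v z * ∫⁻ ζ, ‖kernel α z ζ‖ₑ * a ζ ∂V α) * b z ∂V α
        = ∫⁻ z, (∫⁻ ζ, ‖kernel α z ζ‖ₑ * a ζ ∂V α) * (v z * b z) ∂V α :=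
          lintegral_congr fun z => by ring
      _ ≤ _ := lintegral_kernel_form_le hα ha (hvm.mul hb)
      _ ≤ C₀ * ∑ e ∈ Finset.range 2, C₁ * B ^ max p q *
          ((∫⁻ z, (v z * a z) ^ p ∂V α) ^ (1 / p) * (∫⁻ z, b z ^ q ∂V α) ^ (1 / q)) := by
          gcongr with e
          exact hsparse e
      _ = _ := by
          rw [Finset.sum_const, Finset.card_range, nsmul_eq_mul]
          push_cast
          ring
  have hGm : Measurable fun z => v z * ∫⁻ ζ, ‖kernel α z ζ‖ₑ * a ζ ∂V α := by
    refine hvm.mul (Measurable.lintegral_prod_right' (f := fun x : ℂ × ℂ => ‖kernel α x.1 x.2‖ₑ * a x.2) ?_)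
    exact (measurable_kernel α).enorm.mul (ha.comp measurable_snd)
  have hfinal := lintegral_rpow_le_of_pairing hpq hGm hpair
  have e1 : ∫⁻ z, (‖f z‖ₑ * ∫⁻ ζ, ‖kernel α z ζ‖ₑ * a ζ ∂V α) ^ p ∂V α
      = ∫⁻ z, (v z * ∫⁻ ζ, ‖kernel α z ζ‖ₑ * a ζ ∂V α) ^ p ∂V α := by
    refine lintegral_congr_ae ?_
    filter_upwards [hvf] with z hz
    rw [hz]
  have e2 : ∫⁻ z, (‖f z‖ₑ * a z) ^ p ∂V α = ∫⁻ z, (v z * a z) ^ p ∂V α := by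
    refine lintegral_congr_ae ?_
    filter_upwards [hvf] with z hz
    rw [hz]
  rw [e1, e2]
  exact hfinal

/-! ### Necessity and sufficiency of the Sarason condition. -/

theorem lintegral_enorm_normKernel_sq {α : ℝ} (hα : -1 < α) {w : ℂ} (hw : w ∈ halfPlane) :
    ∫⁻ z, ‖normKernel α w z‖ₑ * ‖normKernel α w z‖ₑ ∂V α = 1 := by
  have hN := kernelNorm_pos hα hw
  have h1 := wnorm_mul_normKernel (p := 2) hα hw fun _ => 1
  simp only [one_mul] at h1
  have h2 : ∫⁻ z, ‖normKernel α w z‖ₑ * ‖normKernel α w z‖ₑ ∂V α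
      = wnorm 2 α (fun z => normKernel α w z) ^ 2 := by
    rw [wnorm_eq_lintegral two_pos, ← ENNReal.rpow_natCast, ← ENNReal.rpow_mul]
    norm_num
    exact lintegral_congr fun z => (sq _).symm
  rw [h2, h1, mul_pow, wnorm_two_kernel_sq hα hw, ← ofReal_norm, ← kernelNorm_sq hα hw,
    ← ENNReal.ofReal_pow (by positivity), ← ENNReal.ofReal_mul (by positivity), inv_pow,
    inv_mul_cancel₀ (by positivity), ENNReal.ofReal_one]

theorem aestronglyMeasurable_inv_V (α : ℝ) {f : ℂ → ℂ} (hf : DifferentiableOn ℂ f halfPlane) :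
    AEStronglyMeasurable (fun z => (f z)⁻¹) (V α) :=
  (aestronglyMeasurable_V α hf).aemeasurable.inv.aestronglyMeasurable

/-- Hölder's inequality for `f k_w` and `f⁻¹ k_w`, whose product is `k_w²` almost everywhere and has
`L¹` norm one. -/
theorem one_le_wnorm_mul_wnorm_inv {α p q : ℝ} (hα : -1 < α) (hpq : p.HolderConjugate q) {f : ℂ → ℂ}
    (hf : DifferentiableOn ℂ f halfPlane) (hf0 : ∃ z ∈ halfPlane, f z ≠ 0) {w : ℂ}
    (hw : w ∈ halfPlane) : 1 ≤ wnorm p α (fun z => f z * normKernel α w z) *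
      wnorm q α (fun z => (f z)⁻¹ * normKernel α w z) := by
  have hk : AEStronglyMeasurable (normKernel α w) (V α) :=
    (measurable_normKernel α w).aestronglyMeasurable
  have h1 := lintegral_mul_le_wnorm hpq ((aestronglyMeasurable_V α hf).mul hk)
    ((aestronglyMeasurable_inv_V α hf).mul hk)
  refine le_trans (le_of_eq ?_) h1
  rw [← lintegral_enorm_normKernel_sq hα hw]
  refine lintegral_congr_ae ?_
  filter_upwards [ae_ne_zero α hf hf0] with z hz
  rw [← enorm_mul]
  congr 1
  simp only [Pi.mul_apply]
  field_simp

theorem wnorm_mul_wnorm_inv_le (p q α : ℝ) (f : ℂ → ℂ) {w : ℂ} (hw : w ∈ halfPlane) :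
    wnorm p α (fun z => f z * normKernel α w z) * wnorm q α (fun z => (f z)⁻¹ * normKernel α w z)
      ≤ invariantConst p q α f :=
  le_iSup₂ (f := fun w (_ : w ∈ halfPlane) => wnorm p α (fun z => f z * normKernel α w z) *
    wnorm q α (fun z => (f z)⁻¹ * normKernel α w z)) w hw

theorem one_le_invariantConst {α p q : ℝ} (hα : -1 < α) (hpq : p.HolderConjugate q) {f : ℂ → ℂ}
    (hf : DifferentiableOn ℂ f halfPlane) (hf0 : ∃ z ∈ halfPlane, f z ≠ 0) :
    1 ≤ invariantConst p q α f := by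
  obtain ⟨w, hw, _⟩ := id hf0
  exact (one_le_wnorm_mul_wnorm_inv hα hpq hf hf0 hw).trans (wnorm_mul_wnorm_inv_le p q α f hw)

/-- A finite product of norms could hide an infinite factor only beside a zero one, which the lower
bound by one excludes. Membership of `f⁻¹ K_w` in `L^q` is what makes the integrals defining `T_ḡ h`
converge. -/
theorem wnorm_inv_mul_kernel_lt_top {α p q : ℝ} (hα : -1 < α) (hpq : p.HolderConjugate q)
    {f : ℂ → ℂ} (hf : DifferentiableOn ℂ f halfPlane) (hf0 : ∃ z ∈ halfPlane, f z ≠ 0)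
    (hinv : invariantConst p q α f < ∞) {w : ℂ} (hw : w ∈ halfPlane) :
    wnorm q α (fun z => (f z)⁻¹ * kernel α z w) < ∞ := by
  rw [wnorm_mul_kernel hα hw]
  refine ENNReal.mul_lt_top ENNReal.ofReal_lt_top (lt_top_iff_ne_top.2 fun ht => ?_)
  have h1 := one_le_wnorm_mul_wnorm_inv hα hpq hf hf0 hw
  have h2 := (wnorm_mul_wnorm_inv_le p q α f hw).trans_lt hinv
  rw [ht] at h1 h2
  rcases eq_or_ne (wnorm p α fun z => f z * normKernel α w z) 0 with h0 | h0
  · rw [h0, zero_mul] at h1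
    exact absurd h1 (by simp)
  · rw [ENNReal.mul_top h0] at h2
    exact lt_irrefl _ h2

/-- A co-analytic Toeplitz operator acts on a kernel function by a scalar. -/
theorem toeplitz_conj_kernel {α : ℝ} (hα : -1 < α) {g : ℂ → ℂ}
    (hg : DifferentiableOn ℂ g halfPlane) {w z : ℂ} (hw : w ∈ halfPlane) (hz : z ∈ halfPlane)
    (h : ToeplitzDefined α (fun ζ => conj (g ζ)) fun ζ => kernel α ζ w) :
    toeplitz α (fun ζ => conj (g ζ)) (fun ζ => kernel α ζ w) z = conj (g w) * kernel α z w := by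
  have hI := h z hz
  -- Conjugation turns the integral into the one that reproduces `g K_z` at `w`.
  have hae : (fun ζ => conj (kernel α z ζ * (conj (g ζ) * kernel α ζ w)))
      =ᵐ[V α] fun ζ => kernel α w ζ * (g ζ * kernel α ζ z) := by
    filter_upwards [ae_V_mem_halfPlane α] with ζ hζ
    rw [map_mul, map_mul, conj_kernel α hz hζ, conj_kernel α hζ hw, Complex.conj_conj]
    ring
  have hI' : Integrable (fun ζ => conj (kernel α z ζ * (conj (g ζ) * kernel α ζ w))) (V α) := by
    refine ⟨Complex.continuous_conj.comp_aestronglyMeasurable hI.1, ?_⟩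
    exact hI.2.congr' (Filter.Eventually.of_forall fun ζ => (Complex.norm_conj _).symm)
  have h1 := integral_kernel_mul hα (hg.mul (differentiableOn_kernel α hz)) hw (hI'.congr hae)
  have h2 : conj (toeplitz α (fun ζ => conj (g ζ)) (fun ζ => kernel α ζ w) z)
      = g w * kernel α w z := by
    rw [toeplitz, proj, ← integral_conj, integral_congr_ae hae]
    exact h1
  rw [← Complex.conj_conj (toeplitz α (fun ζ => conj (g ζ)) (fun ζ => kernel α ζ w) z), h2, map_mul,
    conj_kernel α hw hz]

/-- Boundedness of a Toeplitz product bounds the product of its symbols. -/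
theorem enorm_mul_le_of_prodBoundedBy {α p q : ℝ} (hα : -1 < α) (hpq : p.HolderConjugate q)
    {f g : ℂ → ℂ} (hf : DifferentiableOn ℂ f halfPlane) (hg : DifferentiableOn ℂ g halfPlane)
    {M : ℝ≥0} (h : ProdBoundedBy p α f g M) {w : ℂ} (hw : w ∈ halfPlane) :
    ‖f w * g w‖ₑ ≤ M * (wnorm p α (normKernel α w) * wnorm q α (normKernel α w)) := by
  obtain ⟨h1, h2, h3, h4⟩ := h _ (memBergman_kernel hα hpq.lt hw)
  set T := toeplitz α (fun ζ => conj (g ζ)) (fun ζ => kernel α ζ w) with hT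
  have hTz : ∀ z ∈ halfPlane, T z = conj (g w) * kernel α z w := fun z hz =>
    toeplitz_conj_kernel hα hg hw hz h1
  have hprod : ∀ z ∈ halfPlane, toeplitzProd α f g (fun ζ => kernel α ζ w) z
      = conj (g w) * (f z * kernel α z w) := by
    intro z hz
    have hae : (fun ζ => kernel α z ζ * (f ζ * T ζ)) =ᵐ[V α]
        fun ζ => kernel α z ζ * (conj (g w) * (f ζ * kernel α ζ w)) := by
      filter_upwards [ae_V_mem_halfPlane α] with ζ hζ
      rw [hTz ζ hζ]; ring
    change ∫ ζ, kernel α z ζ * (f ζ * T ζ) ∂V α = _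
    rw [integral_congr_ae hae]
    exact integral_kernel_mul hα ((hf.mul (differentiableOn_kernel α hw)).const_mul (conj (g w))) hz
      ((h2 z hz).congr hae)
  have hN := kernelNorm_pos hα hw
  have h5 : ‖g w‖ₑ * wnorm p α (fun z => f z * kernel α z w) ≤ M * wnorm p α fun z => kernel α z w := by
    refine le_trans (le_of_eq ?_) h4
    have e : wnorm p α (toeplitzProd α f g fun ζ => kernel α ζ w)
        = wnorm p α (conj (g w) • fun z => f z * kernel α z w) := by
      refine eLpNorm_congr_ae ?_
      filter_upwards [ae_V_mem_halfPlane α] with z hz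
      rw [hprod z hz]; rfl
    rw [e, wnorm, wnorm, eLpNorm_const_smul]
    congr 1
    rw [← ofReal_norm, ← ofReal_norm, Complex.norm_conj]
  have h6 : ‖g w‖ₑ * wnorm p α (fun z => f z * normKernel α w z) ≤ M * wnorm p α (normKernel α w) := by
    have e1 := wnorm_mul_normKernel (p := p) hα hw fun _ => 1
    simp only [one_mul] at e1
    change _ ≤ M * wnorm p α fun z => normKernel α w z
    rw [wnorm_mul_normKernel hα hw, e1, mul_left_comm, mul_left_comm (M : ℝ≥0∞)]
    gcongr
  -- The pointwise bound with second function `1` recovers `|f(w)|` from `‖f k_w‖_p`.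
  have h7 := enorm_mul_le_wnorm_mul_wnorm hα hpq hf (differentiableOn_const (1 : ℂ)) hw
  simp only [one_mul, mul_one] at h7
  calc ‖f w * g w‖ₑ = ‖g w‖ₑ * ‖f w‖ₑ := by rw [enorm_mul, mul_comm]
    _ ≤ ‖g w‖ₑ * (wnorm p α (fun z => f z * normKernel α w z) * wnorm q α (normKernel α w)) := by
        gcongr
    _ ≤ (M * wnorm p α (normKernel α w)) * wnorm q α (normKernel α w) := by
        rw [← mul_assoc]; gcongr
    _ = _ := by ring

/-- Off the null set of zeros of `f`, `|g| ≤ B |f|⁻¹`, so `g` may be replaced by `B f⁻¹` in the norm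
with exponent `q`. -/
theorem sarason_le_of_enorm_mul_le {α p q : ℝ} {f g : ℂ → ℂ}
    (hf : DifferentiableOn ℂ f halfPlane) (hf0 : ∃ z ∈ halfPlane, f z ≠ 0) {B : ℝ≥0}
    (h : ∀ w ∈ halfPlane, ‖f w * g w‖ₑ ≤ B) :
    sarason p q α f g ≤ B * invariantConst p q α f := by
  refine iSup₂_le fun w hw => ?_
  have h1 : wnorm q α (fun z => g z * normKernel α w z)
      ≤ B * wnorm q α (fun z => (f z)⁻¹ * normKernel α w z) := by
    have := eLpNorm_le_nnreal_smul_eLpNorm_of_ae_le_mul (μ := V α)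
      (f := fun z => g z * normKernel α w z) (g := fun z => (f z)⁻¹ * normKernel α w z) (c := B) (by
        filter_upwards [ae_V_mem_halfPlane α, ae_ne_zero α hf hf0] with z hz hz0
        have h2 : ‖f z‖₊ * ‖g z‖₊ ≤ B := by
          have := h z hz
          rw [← nnnorm_mul]
          exact_mod_cast this
        have h3 : 0 < ‖f z‖₊ := by simpa using hz0
        rw [nnnorm_mul, nnnorm_mul, nnnorm_inv, ← mul_assoc]
        gcongr
        rw [← div_eq_mul_inv, le_div_iff₀ h3, mul_comm]
        exact h2) (ENNReal.ofReal q)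
    rwa [ENNReal.smul_def, smul_eq_mul] at this
  calc _ ≤ wnorm p α (fun z => f z * normKernel α w z) *
        (B * wnorm q α (fun z => (f z)⁻¹ * normKernel α w z)) := by gcongr
    _ = B * (wnorm p α (fun z => f z * normKernel α w z) *
        wnorm q α (fun z => (f z)⁻¹ * normKernel α w z)) := by ring
    _ ≤ _ := by
        gcongr
        exact wnorm_mul_wnorm_inv_le p q α f hw

/-- Sufficiency of the Sarason condition, with the norm estimate. -/
theorem exists_prodBoundedBy {α p q : ℝ} (hα : -1 < α) (hpq : p.HolderConjugate q) :
    ∃ C : ℝ≥0, ∀ f g : ℂ → ℂ, DifferentiableOn ℂ f halfPlane → DifferentiableOn ℂ g halfPlane →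
      (∃ z ∈ halfPlane, f z ≠ 0) → invariantConst p q α f < ∞ → sarason p q α f g < ∞ →
      ProdBoundedBy p α f g
        (C * (sarason p q α f g).toNNReal * (invariantConst p q α f).toNNReal ^ max p q) := by
  obtain ⟨C, hC⟩ := exists_lintegral_kernel_rpow_le hα hpq
  refine ⟨C, fun f g hf hg hf0 hinv hsar h hh => ?_⟩
  have hp0 := hpq.pos
  have hmax0 : 0 ≤ max p q := hp0.le.trans (le_max_left p q)
  set B := sarason p q α f g with hB
  have hfm := aestronglyMeasurable_V α hf
  have hgm := aestronglyMeasurable_V α hg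
  have hhm := aestronglyMeasurable_V α hh.1
  have hfg : ∀ z ∈ halfPlane, ‖f z * g z‖ₑ ≤ B := fun z hz =>
    (enorm_mul_le_wnorm_mul_wnorm hα hpq hf hg hz).trans
      (le_iSup₂ (f := fun w (_ : w ∈ halfPlane) => wnorm p α (fun z => f z * normKernel α w z) *
        wnorm q α (fun z => g z * normKernel α w z)) z hz)
  have hfgh : (∫⁻ z, (‖f z‖ₑ * ‖g z * h z‖ₑ) ^ p ∂V α) ^ (1 / p) ≤ B * wnorm p α h := by
    rw [wnorm_eq_lintegral hp0]
    calc _ ≤ (∫⁻ z, B ^ p * ‖h z‖ₑ ^ p ∂V α) ^ (1 / p) := by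
          refine ENNReal.rpow_le_rpow (lintegral_mono_ae ?_) (by positivity)
          filter_upwards [ae_V_mem_halfPlane α] with z hz
          rw [← ENNReal.mul_rpow_of_nonneg _ _ hp0.le, enorm_mul, ← mul_assoc, ← enorm_mul]
          refine ENNReal.rpow_le_rpow ?_ hp0.le
          gcongr
          exact hfg z hz
      _ = _ := by
          rw [lintegral_const_mul' _ _ (ENNReal.rpow_ne_top_of_nonneg hp0.le hsar.ne),
            ENNReal.mul_rpow_of_nonneg _ _ (by positivity), ← ENNReal.rpow_mul,
            mul_one_div_cancel hp0.ne', ENNReal.rpow_one]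
  have hBh : B * wnorm p α h < ∞ := ENNReal.mul_lt_top hsar hh.2
  set u : ℂ → ℂ := fun z => conj (g z) * h z with hu
  have hum : AEStronglyMeasurable u (V α) :=
    (Complex.continuous_conj.comp_aestronglyMeasurable hgm).mul hhm
  have hunorm : ∀ z, ‖u z‖ₑ = ‖g z * h z‖ₑ := fun z => by
    rw [hu, ← ofReal_norm, ← ofReal_norm, norm_mul, norm_mul, Complex.norm_conj]
  -- Absolute convergence by Hölder, with `K ḡ h` split in modulus as `f g h` in `L^p` times `f⁻¹ K`
  -- in `L^q`.
  have hdef : ProjDefined α u := by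
    intro z hz
    refine ⟨(measurable_kernel_right α z).aestronglyMeasurable.mul hum, ?_⟩
    have h1 := lintegral_mul_le_wnorm hpq (hfm.mul (hgm.mul hhm))
      ((aestronglyMeasurable_inv_V α hf).mul (measurable_kernel_left α z).aestronglyMeasurable)
    have h2 : wnorm p α (f * (g * h)) < ∞ := by
      rw [wnorm_eq_lintegral hp0]
      simp only [Pi.mul_apply, enorm_mul (f _)]
      exact hfgh.trans_lt hBh
    have h3 := wnorm_inv_mul_kernel_lt_top hα hpq hf hf0 hinv hz
    refine lt_of_le_of_lt (le_of_eq ?_) (h1.trans_lt (ENNReal.mul_lt_top h2 h3))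
    refine lintegral_congr_ae ?_
    filter_upwards [ae_ne_zero α hf hf0] with ζ hζ
    rw [enorm_mul, hunorm, enorm_kernel_comm hα z ζ, ← enorm_mul]
    congr 1
    simp only [Pi.mul_apply]
    field_simp
  set G : ℂ → ℂ := proj α u with hG
  have hGd : DifferentiableOn ℂ G halfPlane := differentiableOn_proj hα hum hdef
  -- This is the value of the Toeplitz product: once `F` is known to be analytic and in `L^p`, its
  -- own projection reproduces it.
  set F : ℂ → ℂ := fun z => f z * G z with hF
  have hFd : DifferentiableOn ℂ F halfPlane := hf.mul hGd
  have hFnorm : wnorm p α F ≤ C * invariantConst p q α f ^ max p q * (B * wnorm p α h) := by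
    -- A measurable representative of `|ḡ h|`, as the weighted bound is stated for measurable
    -- functions.
    set a : ℂ → ℝ≥0∞ := hum.enorm.mk with ha
    have hau : (fun z => ‖u z‖ₑ) =ᵐ[V α] a := hum.enorm.ae_eq_mk
    have h1 := hC f hf hf0 hinv a hum.enorm.measurable_mk
    have h2 : (∫⁻ z, (‖f z‖ₑ * a z) ^ p ∂V α) ^ (1 / p) ≤ B * wnorm p α h := by
      refine le_trans (le_of_eq ?_) hfgh
      congr 1
      refine lintegral_congr_ae ?_
      filter_upwards [hau] with z hz
      rw [← hz, hunorm]
    rw [wnorm_eq_lintegral hp0]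
    calc (∫⁻ z, ‖F z‖ₑ ^ p ∂V α) ^ (1 / p)
        ≤ (∫⁻ z, (‖f z‖ₑ * ∫⁻ ζ, ‖kernel α z ζ‖ₑ * a ζ ∂V α) ^ p ∂V α) ^ (1 / p) := by
          refine ENNReal.rpow_le_rpow (lintegral_mono fun z => ?_) (by positivity)
          refine ENNReal.rpow_le_rpow ?_ hp0.le
          rw [hF, enorm_mul]
          gcongr
          refine (enorm_integral_le_lintegral_enorm _).trans (le_of_eq ?_)
          refine lintegral_congr_ae ?_
          filter_upwards [hau] with ζ hζ
          rw [enorm_mul, ← hζ]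
      _ ≤ ((C * invariantConst p q α f ^ max p q *
          (∫⁻ z, (‖f z‖ₑ * a z) ^ p ∂V α) ^ (1 / p)) ^ p) ^ (1 / p) :=
          ENNReal.rpow_le_rpow h1 (by positivity)
      _ = C * invariantConst p q α f ^ max p q * (∫⁻ z, (‖f z‖ₑ * a z) ^ p ∂V α) ^ (1 / p) := by
          rw [← ENNReal.rpow_mul, mul_one_div_cancel hp0.ne', ENNReal.rpow_one]
      _ ≤ _ := by gcongr
  have hFt : wnorm p α F < ∞ := hFnorm.trans_lt (ENNReal.mul_lt_top (ENNReal.mul_lt_top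
    ENNReal.coe_lt_top (ENNReal.rpow_lt_top_of_nonneg hmax0 hinv.ne)) hBh)
  have hdef2 : ProjDefined α F := by
    intro z hz
    refine ⟨(measurable_kernel_right α z).aestronglyMeasurable.mul (aestronglyMeasurable_V α hFd), ?_⟩
    have h1 := lintegral_mul_le_wnorm hpq (aestronglyMeasurable_V α hFd)
      (measurable_kernel_left α z).aestronglyMeasurable
    refine lt_of_le_of_lt (le_of_eq ?_) (h1.trans_lt (ENNReal.mul_lt_top hFt
      (wnorm_kernel_lt_top hα hpq.symm.lt hz)))
    refine lintegral_congr fun ζ => ?_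
    rw [enorm_mul (kernel α z ζ), enorm_kernel_comm hα z ζ, mul_comm, ← enorm_mul]
  have hprod : EqOn (toeplitzProd α f g h) F halfPlane := fun z hz =>
    integral_kernel_mul hα hFd hz (hdef2 z hz)
  have hw : wnorm p α (toeplitzProd α f g h) = wnorm p α F := by
    refine eLpNorm_congr_ae ?_
    filter_upwards [ae_V_mem_halfPlane α] with z hz
    exact hprod hz
  refine ⟨hdef, hdef2, ⟨hFd.congr hprod, by rwa [hw]⟩, ?_⟩
  rw [hw]
  refine hFnorm.trans (le_of_eq ?_)
  push_cast
  rw [ENNReal.coe_rpow_of_nonneg _ hmax0, ENNReal.coe_toNNReal hsar.ne,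
    ENNReal.coe_toNNReal hinv.ne]
  ring

end BergmanHalfPlane

end

/-! ### The equivalence and the two norm estimates. -/

theorem mainTheorem1 (p q α : ℝ) (hpq : p.HolderConjugate q) (hα : -1 < α) :
    ∃ C : NNReal, ∀ f g : ℂ → ℂ,
      DifferentiableOn ℂ f BergmanHalfPlane.halfPlane →
      DifferentiableOn ℂ g BergmanHalfPlane.halfPlane →
      (∃ z ∈ BergmanHalfPlane.halfPlane, f z ≠ 0) →
      BergmanHalfPlane.invariantConst p q α f < ⊤ →
      (BergmanHalfPlane.ProdBounded p α f g ↔ BergmanHalfPlane.sarason p q α f g < ⊤) ∧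
      BergmanHalfPlane.prodNorm p α f g ≤
        C * BergmanHalfPlane.sarason p q α f g *
          BergmanHalfPlane.invariantConst p q α f ^ (max p q) ∧
      BergmanHalfPlane.sarason p q α f g ≤
        C * BergmanHalfPlane.prodNorm q α g f * BergmanHalfPlane.invariantConst p q α f := by
  open BergmanHalfPlane in
  obtain ⟨C₁, hC₁⟩ := exists_prodBoundedBy hα hpq
  obtain ⟨C₂, hC₂⟩ := exists_wnorm_normKernel_mul_le hα hpq
  have hmax0 : 0 ≤ max p q := hpq.nonneg.trans (le_max_left p q)
  -- The entry `1` keeps the constant nonzero, for the convention `0 * ∞ = 0` and for the division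
  -- below.
  refine ⟨max 1 (max C₁ C₂), fun f g hf hg hf0 hinv => ?_⟩
  set C : NNReal := max 1 (max C₁ C₂) with hC
  have hC0 : (C : ENNReal) ≠ 0 := by
    have : (1 : NNReal) ≤ C := le_max_left _ _
    exact_mod_cast (zero_lt_one.trans_le this).ne'
  have hC1 : C₁ ≤ C := (le_max_left _ _).trans (le_max_right _ _)
  have hC2 : C₂ ≤ C := (le_max_right _ _).trans (le_max_right _ _)
  have hB0 : invariantConst p q α f ≠ 0 :=
    (zero_lt_one.trans_le (one_le_invariantConst hα hpq hf hf0)).ne'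
  -- The common part of both necessity statements: it uses the operator only through a bound on `|f
  -- g|`, so it applies to `T_f T_ḡ` on `A^p` and to `T_g T_f̄` on `A^q`.
  have hnec : ∀ M : NNReal, (∀ w ∈ halfPlane, ‖f w * g w‖ₑ ≤ (M * C₂ : NNReal)) →
      sarason p q α f g ≤ C * M * invariantConst p q α f := by
    intro M h
    refine (sarason_le_of_enorm_mul_le hf hf0 h).trans ?_
    rw [ENNReal.coe_mul, mul_comm (M : ENNReal)]
    gcongr
  refine ⟨⟨?_, fun hs => ⟨_, hC₁ f g hf hg hf0 hinv hs⟩⟩, ?_, ?_⟩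
  · rintro ⟨M, hM⟩
    refine (hnec M fun w hw => ?_).trans_lt
      (ENNReal.mul_lt_top (ENNReal.mul_lt_top ENNReal.coe_lt_top ENNReal.coe_lt_top) hinv)
    refine (enorm_mul_le_of_prodBoundedBy hα hpq hf hg hM hw).trans ?_
    rw [ENNReal.coe_mul]
    gcongr
    exact hC₂ w hw
  · rcases eq_or_ne (sarason p q α f g) ⊤ with hs | hs
    · rw [hs, ENNReal.mul_top hC0, ENNReal.top_mul]
      · exact le_top
      · simp [ENNReal.rpow_eq_zero_iff, hB0, hinv.ne]
    · refine (iInf₂_le _ (hC₁ f g hf hg hf0 hinv hs.lt_top)).trans ?_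
      rw [ENNReal.coe_mul, ENNReal.coe_mul, ENNReal.coe_rpow_of_nonneg _ hmax0,
        ENNReal.coe_toNNReal hs, ENNReal.coe_toNNReal hinv.ne]
      gcongr
  -- Dividing by the finite nonzero factor puts the estimate in a form that passes to the infimum
  -- over `M`, including an empty one when the product is unbounded.
  · have key : ∀ M : NNReal, ProdBoundedBy q α g f M →
        sarason p q α f g / (C * invariantConst p q α f) ≤ M := by
      intro M hM
      refine ENNReal.div_le_of_le_mul ?_
      refine (hnec M fun w hw => ?_).trans (le_of_eq (by ring))
      rw [mul_comm (f w)]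
      refine (enorm_mul_le_of_prodBoundedBy hα hpq.symm hg hf hM hw).trans ?_
      rw [ENNReal.coe_mul, mul_comm (wnorm q α _)]
      gcongr
      exact hC₂ w hw
    have h1 : sarason p q α f g / (C * invariantConst p q α f) ≤ prodNorm q α g f :=
      le_iInf₂ key
    rw [ENNReal.div_le_iff (mul_ne_zero hC0 hB0) (ENNReal.mul_ne_top ENNReal.coe_ne_top hinv.ne)]
      at h1
    exact h1.trans (le_of_eq (by ring))
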